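/- Let $Q$ be an $n$-dimensional smooth manifold, $k\ge 1$, and let $L\in C^\infty(T^kQ)$, where $T^mQ=J^m_0(\mathbb R,Q)$ is the $m$-th order tangent bundle, with projections $\rho^m_r:T^mQ\to T^rQ$ and natural coordinates $q_i^A=\frac{d^i(\varphi^A\circ\sigma)}{dt^i}(0)$, $0\le i\le m$, of the jet of a curve $\sigma$ in a chart $\varphi$ of $Q$. Let * $j_r:T^mQ\to T(T^{r-1}Q)$, $1\le r\le m$, be the map sending the $m$-jet at $0$ of a curve $\sigma$ to the velocity at $t=0$ of its canonical lifting to $T^{r-1}Q$; * $J_r=\sum_{i=0}^{k-r}\frac{(r+i)!}{i!}\,dq_i^A\otimes\frac{\partial}{\partial q_{r+i}^A}$ and $\Delta_r=\sum_{i=0}^{k-r}\frac{(r+i)!}{i!}\,q_{i+1}^A\frac{\partial}{\partial q_{r+i}^A}$, $1\le r\le k$, be the vertical endomorphisms and the canonical vector fields of $T^kQ$, and $d_{J_r}L=dL\circ J_r$; * $d_T$ be Tulczyjew's derivation, which maps functions (resp. $1$-forms) on $T^mQ$ to functions (resp. $1$-forms) on $T^{m+1}Q$ and is given by $(d_Tf)(p)=df_{\rho^{m+1}_m(p)}(j_{m+1}(p))$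 and $d_T(a\,dq_i^A)=(d_Ta)\,dq_i^A+a\,dq_{i+1}^A$; * $\theta_L=\sum_{r=1}^k\frac{(-1)^{r-1}}{r!}\,d_T^{r-1}d_{J_r}L\in\Omega^1(T^{2k-1}Q)$ be the Lagrangian $1$-form, where each term is pulled back to $T^{2k-1}Q$ along $\rho^{2k-1}_{k+r-1}$. The Legendre–Ostrogradsky map $\mathcal{FL}:T^{2k-1}Q\to T^*(T^{k-1}Q)$ is well defined by requiring $\mathcal{FL}(p)$ to be the unique covector $\alpha$ at $\rho^{2k-1}_{k-1}(p)$ such that $\theta_L(u)=\langle \alpha, T\rho^{2k-1}_{k-1}(u)\rangle$ for all $u\in T_p(T^{2k-1}Q)$. Let $W=T^{2k-1}Q\times_{T^{k-1}Q}T^*(T^{k-1}Q)$ with first projection $\mathrm{pr}_1$, let $C(p,\alpha)=\langle\alpha, j_k(p)\rangle$ be the coupling function and $H=C-(\rho^{2k-1}_k\circ \mathrm{pr}_1)^*L$ the unified Hamiltonian on $W$, and let $W_o=\{(p,\mathcal{FL}(p)) : p\in T^{2k-1}Q\}\subset W$ be the graph of $\mathcal{FL}$. Then there exists a unique function $E\in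 C^\infty(T^{2k-1}Q)$ such that $E\circ\mathrm{pr}_1=H$ on $W_o$. This function is the Lagrangian energy $$E_L=\sum_{r=1}^k\frac{(-1)^{r-1}}{r!}\,d_T^{r-1}(\Delta_r(L))-L,$$ where each term is pulled back to $T^{2k-1}Q$ along the projection $\rho^{2k-1}_{k+r-1}$, and $L$ along $\rho^{2k-1}_k$. -/

import Mathlib

open scoped Manifold ContDiff Topology

noncomputable section

namespace HigherOrder

/-- The coordinate space of an `n`-dimensional manifold. -/
abbrev Coord (n : ℕ) := EuclideanSpace ℝ (Fin n)

/-- The coordinate space of `T^k Q`: tuples `(q_0, …, q_k)`, each `q_i` having components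
`q_i^A`, `A : Fin n`. -/
abbrev JetCoord (n k : ℕ) := Fin (k + 1) → Coord n

section Jets

variable (n k : ℕ) (Q : Type*) [TopologicalSpace Q] [ChartedSpace (Coord n) Q]

/-- Smooth curves `ℝ → Q`. -/
abbrev Curve := ContMDiffMap 𝓘(ℝ, ℝ) (𝓡 n) ℝ Q ∞

variable {n Q}

/-- The `i`-th derivative at time `t` of the curve `σ` read in the chart at `x`. -/
def derivIn (x : Q) (σ : Curve n Q) (t : ℝ) (i : ℕ) : Coord n :=
  iteratedDeriv i (fun s => chartAt (Coord n) x (σ s)) t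

variable (n Q)

/-- Equality of `k`-jets at `0` of smooth curves in `Q`. -/
def jetSetoid : Setoid (Curve n Q) where
  r σ τ := σ 0 = τ 0 ∧ ∀ i ≤ k, derivIn (σ 0) σ 0 i = derivIn (σ 0) τ 0 i
  iseqv :=
    { refl := fun _ => ⟨rfl, fun _ _ => rfl⟩
      symm := by
        intro σ τ h
        obtain ⟨h0, h1⟩ := h
        exact ⟨h0.symm, fun i hi => by rw [← h0]; exact (h1 i hi).symm⟩
      trans := by
        intro σ τ υ h h'
        obtain ⟨h0, h1⟩ := h
        obtain ⟨h0', h1'⟩ := h'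
        exact ⟨h0.trans h0', fun i hi => by rw [h1 i hi, h0]; exact h1' i hi⟩ }

/-- The `k`-th order tangent bundle `T^k Q = J_0^k(ℝ, Q)`. -/
def HOTangent := Quotient (jetSetoid n k Q)

variable {n Q}

/-- The `k`-jet at `0` of a curve. -/
def jet (σ : Curve n Q) : HOTangent n k Q := Quotient.mk (jetSetoid n k Q) σ

variable {k}

/-- The projection `β^k : T^k Q → Q`. -/
def HOTangent.base (p : HOTangent n k Q) : Q :=
  Quotient.lift (s := jetSetoid n k Q) (fun σ : Curve n Q => σ 0) (fun _ _ h => h.1) p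

/-- The projection `ρ^k_r : T^k Q → T^r Q`. -/
def proj {r : ℕ} (h : r ≤ k) (p : HOTangent n k Q) : HOTangent n r Q :=
  Quotient.map' (s₁ := jetSetoid n k Q) (s₂ := jetSetoid n r Q) id
    (fun _ _ hστ => ⟨hστ.1, fun i hi => hστ.2 i (hi.trans h)⟩) p

variable (k)

/-- The curve `σ_t`, `σ_t(s) = σ(s + t)`. -/
def shift (σ : Curve n Q) (t : ℝ) : Curve n Q :=
  ⟨fun s => σ (s + t), σ.contMDiff.comp (contMDiff_iff_contDiff.2 (by fun_prop))⟩

/-- The canonical lifting of `σ` to `T^k Q`. -/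
def lift (σ : Curve n Q) (t : ℝ) : HOTangent n k Q := jet k (shift σ t)

variable {k}

/-- The natural coordinates on `T^k Q` induced by the chart of `Q` at `x`:
`q_i = d^i/dt^i (φ ∘ σ)(0)`, for any curve `σ` representing the jet (see `natCoord_jet`). -/
def natCoord (x : Q) (p : HOTangent n k Q) : JetCoord n k :=
  fun i => derivIn x (Quotient.out p) 0 i

theorem jet_surj (p : HOTangent n k Q) : ∃ σ : Curve n Q, jet k σ = p := Quotient.exists_rep p

theorem jet_eq_jet {σ τ : Curve n Q} : jet k σ = jet k τ ↔
    σ 0 = τ 0 ∧ ∀ i ≤ k, derivIn (σ 0) σ 0 i = derivIn (σ 0) τ 0 i :=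
  Quotient.eq (r := jetSetoid n k Q)

theorem derivIn_shift (x : Q) (σ : Curve n Q) (t : ℝ) (i : ℕ) :
    derivIn x (shift σ t) 0 i = derivIn x σ t i := by
  have := congrFun (iteratedDeriv_comp_add_const i (fun s => chartAt (Coord n) x (σ s)) t) 0
  rw [zero_add] at this
  exact this

theorem contMDiffAt_chart [IsManifold (𝓡 n) ∞ Q] {x y : Q}
    (hy : y ∈ (chartAt (Coord n) x).source) :
    ContMDiffAt (𝓡 n) (𝓡 n) ∞ (chartAt (Coord n) x) y :=
  contMDiffAt_of_mem_maximalAtlas (IsManifold.chart_mem_maximalAtlas x) hy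

theorem contDiffAt_chart_comp [IsManifold (𝓡 n) ∞ Q] {x : Q} {σ : Curve n Q} {t : ℝ}
    (hx : σ t ∈ (chartAt (Coord n) x).source) :
    ContDiffAt ℝ ∞ (fun s => chartAt (Coord n) x (σ s)) t := by
  rw [← contMDiffAt_iff_contDiffAt]
  exact (contMDiffAt_chart hx).comp t (σ.contMDiff t)

/-- The change of charts of `Q` from the chart at `x` to the chart at `y`. -/
def trans (x y : Q) : Coord n → Coord n :=
  fun q => chartAt (Coord n) y ((chartAt (Coord n) x).symm q)

theorem contDiffAt_trans [IsManifold (𝓡 n) ∞ Q] {x y : Q} {q : Coord n}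
    (hq : q ∈ (chartAt (Coord n) x).target)
    (hq' : (chartAt (Coord n) x).symm q ∈ (chartAt (Coord n) y).source) :
    ContDiffAt ℝ ∞ (trans x y) q := by
  rw [← contMDiffAt_iff_contDiffAt]
  exact (contMDiffAt_chart hq').comp q
    (contMDiffAt_symm_of_mem_maximalAtlas (IsManifold.chart_mem_maximalAtlas x) hq)

/-- The change of natural coordinates (Faà di Bruno formula). -/
def transJet (x y : Q) (q : JetCoord n k) : JetCoord n k := fun i =>
  ∑ c : OrderedFinpartition i, iteratedFDeriv ℝ c.length (trans x y) (q 0)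
    fun j => q (Fin.ofNat (k + 1) (c.partSize j))

theorem derivIn_trans [IsManifold (𝓡 n) ∞ Q] {x y : Q} {σ : Curve n Q} {t : ℝ}
    (hx : σ t ∈ (chartAt (Coord n) x).source) (hy : σ t ∈ (chartAt (Coord n) y).source) (i : ℕ) :
    derivIn y σ t i = ∑ c : OrderedFinpartition i,
      iteratedFDeriv ℝ c.length (trans x y) (chartAt (Coord n) x (σ t))
        fun j => derivIn x σ t (c.partSize j) := by
  have hg : ContDiffAt ℝ ∞ (trans x y) (chartAt (Coord n) x (σ t)) :=
    contDiffAt_trans ((chartAt (Coord n) x).map_source hx)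
      (by rwa [(chartAt (Coord n) x).left_inv hx])
  have := iteratedDeriv_vcomp_eq_sum_orderedFinpartition (i := i) hg
    (contDiffAt_chart_comp hx) (by exact_mod_cast le_top)
  refine Eq.trans ?_ this
  · refine Filter.EventuallyEq.iteratedDeriv_eq i ?_
    have : ∀ᶠ s in 𝓝 t, σ s ∈ (chartAt (Coord n) x).source :=
      σ.contMDiff.continuous.continuousAt.eventually_mem
        ((chartAt (Coord n) x).open_source.mem_nhds hx)
    filter_upwards [this] with s hs
    simp [trans, (chartAt (Coord n) x).left_inv hs]

theorem derivIn_congr [IsManifold (𝓡 n) ∞ Q] {σ τ : Curve n Q} (h : jet k σ = jet k τ) {x : Q}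
    (hx : σ 0 ∈ (chartAt (Coord n) x).source) {i : ℕ} (hi : i ≤ k) :
    derivIn x σ 0 i = derivIn x τ 0 i := by
  obtain ⟨h0, h1⟩ := jet_eq_jet.1 h
  rw [derivIn_trans (mem_chart_source _ (σ 0)) hx,
    derivIn_trans (x := σ 0) (by rw [← h0]; exact mem_chart_source _ (σ 0)) (h0 ▸ hx), h0]
  refine Finset.sum_congr rfl fun c _ => ?_
  congr 1
  funext j
  rw [← h0, h1 _ ((c.partSize_le j).trans hi)]

theorem natCoord_jet [IsManifold (𝓡 n) ∞ Q] {x : Q} {σ : Curve n Q}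
    (hx : σ 0 ∈ (chartAt (Coord n) x).source) :
    natCoord x (jet k σ) = fun i : Fin (k + 1) => derivIn x σ 0 i := by
  funext i
  have h : jet k (Quotient.out (jet k σ)) = jet k σ := Quotient.out_eq _
  refine derivIn_congr h ?_ (Nat.lt_succ_iff.1 i.2)
  rwa [(jet_eq_jet.1 h).1]

theorem exists_cutoff {ε : ℝ} (hε : 0 < ε) :
    ∃ χ : ℝ → ℝ, ContDiff ℝ ∞ χ ∧ (∀ᶠ t in 𝓝 0, χ t = t) ∧ ∀ t, |χ t| < ε := by
  let b : ContDiffBump (0 : ℝ) := ⟨ε / 2, ε, by positivity, by linarith⟩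
  refine ⟨fun t => b t * t, b.contDiff.mul contDiff_id, ?_, fun t => ?_⟩
  rotate_left
  · change |b t * t| < ε
    by_cases h : |t| < ε
    · rw [abs_mul, abs_of_nonneg b.nonneg]
      exact (mul_le_of_le_one_left (abs_nonneg t) b.le_one).trans_lt h
    · rw [b.zero_of_le_dist (by simpa [b] using h)]
      simpa using hε
  · filter_upwards [b.eventuallyEq_one] with t ht
    simp [ht]

/-- Every point of the coordinate domain is attained by the jet of a smooth curve. -/
theorem exists_curve [IsManifold (𝓡 n) ∞ Q] (x : Q) (q : JetCoord n k)
    (hq : q 0 ∈ (chartAt (Coord n) x).target) :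
    ∃ σ : Curve n Q, σ 0 ∈ (chartAt (Coord n) x).source ∧
      ∀ i : Fin (k + 1), derivIn x σ 0 i = q i := by
  let P : ℝ → Coord n := fun t => ∑ j : Fin (k + 1), t ^ (j : ℕ) • (((j : ℕ).factorial : ℝ)⁻¹ • q j)
  have hP : ContDiff ℝ ∞ P := by fun_prop
  have hP0 : P 0 = q 0 := by
    simp only [P]
    rw [Finset.sum_eq_single 0]
    · simp
    · intro j _ hj
      have : (j : ℕ) ≠ 0 := fun h => hj (Fin.ext h)
      simp [this]
    · simp
  have hPi (i : Fin (k + 1)) : iteratedDeriv i P 0 = q i := by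
    have h1 : iteratedDeriv i P 0 = ∑ j : Fin (k + 1), iteratedDeriv i
        (fun t : ℝ => t ^ (j : ℕ) • (((j : ℕ).factorial : ℝ)⁻¹ • q j)) 0 := by
      simp only [P]
      rw [iteratedDeriv_fun_sum]
      intro j _
      fun_prop
    rw [h1, Finset.sum_eq_single i]
    · rw [iteratedDeriv_smul_const (by fun_prop), iteratedDeriv_fun_pow_zero, if_pos rfl, smul_smul,
        mul_inv_cancel₀ (by positivity), one_smul]
    · intro j _ hj
      rw [iteratedDeriv_smul_const (by fun_prop), iteratedDeriv_fun_pow_zero,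
        if_neg fun h => hj (Fin.ext h.symm), Nat.cast_zero, zero_smul]
    · simp
  obtain ⟨ε, hε, hball⟩ : ∃ ε > 0, ∀ t, |t| < ε → P t ∈ (chartAt (Coord n) x).target := by
    have : ∀ᶠ t in 𝓝 0, P t ∈ (chartAt (Coord n) x).target :=
      hP.continuous.continuousAt.eventually_mem
        ((chartAt (Coord n) x).open_target.mem_nhds (hP0 ▸ hq))
    obtain ⟨ε, hε, h⟩ := Metric.eventually_nhds_iff.1 this
    exact ⟨ε, hε, fun t ht => h (by simpa using ht)⟩
  obtain ⟨χ, hχ, hχ0, hχε⟩ := exists_cutoff hε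
  have hmem (t : ℝ) : P (χ t) ∈ (chartAt (Coord n) x).target := hball _ (hχε t)
  have hsm : ContMDiff 𝓘(ℝ, ℝ) (𝓡 n) ∞ fun t => (chartAt (Coord n) x).symm (P (χ t)) := fun t =>
    (contMDiffAt_symm_of_mem_maximalAtlas (IsManifold.chart_mem_maximalAtlas x) (hmem t)).comp t
      (contMDiffAt_iff_contDiffAt.2 (hP.comp hχ).contDiffAt)
  refine ⟨⟨_, hsm⟩, (chartAt (Coord n) x).map_target (hmem 0), fun i => ?_⟩
  rw [← hPi i]
  refine Filter.EventuallyEq.iteratedDeriv_eq _ ?_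
  filter_upwards [hχ0] with t ht
  change chartAt (Coord n) x ((chartAt (Coord n) x).symm (P (χ t))) = P t
  rw [(chartAt (Coord n) x).right_inv (hmem t), ht]

/-- The natural chart of `T^k Q` induced by the chart of `Q` at `x`. -/
def jetChart [IsManifold (𝓡 n) ∞ Q] (x : Q) : PartialEquiv (HOTangent n k Q) (JetCoord n k) where
  toFun := natCoord x
  invFun q := open Classical in
    if hq : q 0 ∈ (chartAt (Coord n) x).target then jet k (exists_curve x q hq).choose
    else jet k (ContMDiffMap.const x)
  source := {p | p.base ∈ (chartAt (Coord n) x).source}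
  target := {q | q 0 ∈ (chartAt (Coord n) x).target}
  map_source' := by
    intro p hp
    obtain ⟨σ, rfl⟩ := jet_surj p
    have hσ : σ 0 ∈ (chartAt (Coord n) x).source := hp
    rw [natCoord_jet hσ]
    simpa [derivIn] using (chartAt (Coord n) x).map_source hσ
  map_target' := by
    intro q hq
    have hq' : q 0 ∈ (chartAt (Coord n) x).target := hq
    simp only [dif_pos hq']
    exact (exists_curve x q hq').choose_spec.1
  left_inv' := by
    intro p hp
    obtain ⟨σ, rfl⟩ := jet_surj p
    have hσ : σ 0 ∈ (chartAt (Coord n) x).source := hp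
    have hq : natCoord x (jet k σ) 0 ∈ (chartAt (Coord n) x).target := by
      rw [natCoord_jet hσ]
      simpa [derivIn] using (chartAt (Coord n) x).map_source hσ
    simp only [dif_pos hq]
    obtain ⟨h1, h2⟩ := (exists_curve x _ hq).choose_spec
    generalize (exists_curve x _ hq).choose = τ at h1 h2
    rw [natCoord_jet hσ] at h2
    have h0 : τ 0 = σ 0 := by
      refine (chartAt (Coord n) x).injOn h1 hσ ?_
      simpa [derivIn] using h2 0
    refine jet_eq_jet.2 ⟨h0, fun i hi => ?_⟩
    rw [derivIn_trans h1 (mem_chart_source _ _),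
      derivIn_trans (x := x) hσ (by rw [← h0]; exact mem_chart_source _ (τ 0)), h0]
    refine Finset.sum_congr rfl fun c _ => ?_
    congr 1
    funext j
    exact h2 ⟨c.partSize j, Nat.lt_succ_iff.2 ((c.partSize_le j).trans hi)⟩
  right_inv' := by
    intro q hq
    have hq' : q 0 ∈ (chartAt (Coord n) x).target := hq
    simp only [dif_pos hq']
    obtain ⟨h1, h2⟩ := (exists_curve x q hq').choose_spec
    rw [natCoord_jet h1]
    exact funext h2

/-- In natural coordinates, changes of charts are given by the Faà di Bruno formula. -/
theorem natCoord_trans [IsManifold (𝓡 n) ∞ Q] {x y : Q} {p : HOTangent n k Q}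
    (hx : p.base ∈ (chartAt (Coord n) x).source) (hy : p.base ∈ (chartAt (Coord n) y).source) :
    natCoord y p = transJet x y (natCoord x p) := by
  obtain ⟨σ, rfl⟩ := jet_surj p
  rw [natCoord_jet hx, natCoord_jet hy]
  funext i
  rw [derivIn_trans hx hy]
  refine Finset.sum_congr rfl fun c _ => ?_
  have h0 : derivIn x σ 0 ((0 : Fin (k + 1)) : ℕ) = chartAt (Coord n) x (σ 0) := by
    simp [derivIn]
  simp only [h0]
  congr 1
  funext j
  rw [Fin.val_ofNat, Nat.mod_eq_of_lt]
  exact Nat.lt_succ_iff.2 ((c.partSize_le j).trans (Nat.lt_succ_iff.1 i.2))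

theorem jetChart_trans_source [IsManifold (𝓡 n) ∞ Q] (x y : Q) :
    ((jetChart (n := n) (k := k) (Q := Q) x).symm.trans (jetChart y)).source =
      {q | q 0 ∈ ((chartAt (Coord n) x).symm.trans (chartAt (Coord n) y)).source} := by
  ext q
  have key (hq : q 0 ∈ (chartAt (Coord n) x).target) :
      ((jetChart x).symm q : HOTangent n k Q).base = (chartAt (Coord n) x).symm (q 0) := by
    have h1 := (jetChart x).map_target (show q ∈ (jetChart (k := k) x).target from hq)
    have h2 := (jetChart x).right_inv (show q ∈ (jetChart (k := k) x).target from hq)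
    obtain ⟨σ, hσ⟩ := jet_surj ((jetChart x).symm q)
    rw [← hσ] at h1 h2 ⊢
    have h1' : σ 0 ∈ (chartAt (Coord n) x).source := h1
    have h3 : chartAt (Coord n) x (σ 0) = q 0 := by
      rw [← h2]
      change _ = natCoord x (jet k σ) 0
      rw [natCoord_jet h1']
      simp [derivIn]
    rw [← h3, (chartAt (Coord n) x).left_inv h1']
    rfl
  simp only [PartialEquiv.trans_source, OpenPartialHomeomorph.trans_source, Set.mem_inter_iff,
    Set.mem_preimage, Set.mem_ofPred_eq]
  refine and_congr_right fun hq => ?_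
  change ((jetChart x).symm q : HOTangent n k Q).base ∈ (chartAt (Coord n) y).source ↔ _
  rw [key hq]

theorem contDiffOn_jetChart_trans [IsManifold (𝓡 n) ∞ Q] (x y : Q) :
    ContDiffOn ℝ ∞ ((jetChart (n := n) (k := k) (Q := Q) x).symm.trans (jetChart y))
      ((jetChart (n := n) (k := k) (Q := Q) x).symm.trans (jetChart y)).source := by
  have h : ContDiffOn ℝ ∞ (transJet (k := k) x y)
      ((jetChart (n := n) (k := k) (Q := Q) x).symm.trans (jetChart y)).source := by
    rw [jetChart_trans_source]
    intro q hq
    refine ContDiffAt.contDiffWithinAt (contDiffAt_pi.2 fun i => ContDiffAt.sum fun c _ => ?_)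
    have h1 : ContDiffAt ℝ ∞ (iteratedFDeriv ℝ c.length (trans x y)) (q 0) :=
      (contDiffAt_trans hq.1 hq.2).iteratedFDeriv_right le_rfl
    have h2 : ContDiffAt ℝ ∞ (fun q : JetCoord n k => (iteratedFDeriv ℝ c.length (trans x y) (q 0),
        fun j => q (Fin.ofNat (k + 1) (c.partSize j)))) q :=
      ContDiffAt.prodMk (h1.comp q (by fun_prop)) (by fun_prop)
    exact ((ContinuousLinearMap.id ℝ (ContinuousMultilinearMap ℝ (fun _ : Fin c.length => Coord n)
      (Coord n))).analyticAt_uncurry_of_multilinear).contDiffAt.comp q h2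
  refine h.congr fun q hq => ?_
  have hx := (jetChart x).map_target hq.1
  change natCoord y ((jetChart x).symm q) = _
  rw [natCoord_trans (x := x) hx hq.2]
  congr 1
  exact (jetChart x).right_inv hq.1

variable (n k Q)

/-- The natural atlas of `T^k Q`. -/
def jetCore [IsManifold (𝓡 n) ∞ Q] : ChartedSpaceCore (JetCoord n k) (HOTangent n k Q) where
  atlas := Set.range jetChart
  chartAt p := jetChart p.base
  mem_chart_source p := mem_chart_source (Coord n) p.base
  chart_mem_atlas p := ⟨p.base, rfl⟩
  open_source := by
    rintro _ _ ⟨x, rfl⟩ ⟨y, rfl⟩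
    rw [jetChart_trans_source]
    exact (((chartAt (Coord n) x).symm.trans (chartAt (Coord n) y)).open_source).preimage
      (continuous_apply 0)
  continuousOn_toFun := by
    rintro _ _ ⟨x, rfl⟩ ⟨y, rfl⟩
    exact (contDiffOn_jetChart_trans x y).continuousOn

instance [IsManifold (𝓡 n) ∞ Q] : TopologicalSpace (HOTangent n k Q) :=
  (jetCore n k Q).toTopologicalSpace

/-- `T^k Q` with its natural charts; the preferred chart at `p` is the natural chart induced by
the preferred chart of `Q` at `β^k(p)`. -/
instance [IsManifold (𝓡 n) ∞ Q] : ChartedSpace (JetCoord n k) (HOTangent n k Q) :=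
  (jetCore n k Q).toChartedSpace

instance [IsManifold (𝓡 n) ∞ Q] :
    IsManifold 𝓘(ℝ, JetCoord n k) ∞ (HOTangent n k Q) := by
  refine isManifold_of_contDiffOn _ _ _ fun e e' he he' => ?_
  obtain ⟨_, ⟨_, rfl⟩, ⟨_, ⟨⟨x, rfl⟩, rfl⟩, rfl⟩⟩ := he
  obtain ⟨_, ⟨_, rfl⟩, ⟨_, ⟨⟨y, rfl⟩, rfl⟩, rfl⟩⟩ := he'
  have h := contDiffOn_jetChart_trans (n := n) (k := k) (Q := Q) x y
  simp only [modelWithCornersSelf_coe, modelWithCornersSelf_coe_symm, Function.id_comp,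
    Function.comp_id, Set.preimage_id, Set.range_id, Set.inter_univ]
  exact h

end Jets

section Geometry

variable {n k : ℕ} {Q : Type*} [TopologicalSpace Q] [ChartedSpace (Coord n) Q]
  [IsManifold (𝓡 n) ∞ Q]

/-- The tangent space `T_p(T^k Q)`. In Mathlib a tangent vector at `p` is given by its components
`(v_0, …, v_k)` in the preferred chart at `p`, here the natural chart over the preferred chart of
`Q` at `β^k(p)`. -/
abbrev TSp (p : HOTangent n k Q) := TangentSpace 𝓘(ℝ, JetCoord n k) p

/-- The cotangent space `T*_p(T^k Q)`. -/
abbrev CoTSp (p : HOTangent n k Q) := TSp p →L[ℝ] ℝ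

/-- The differential `d f` of a function at a point. -/
def dFun (f : HOTangent n k Q → ℝ) (p : HOTangent n k Q) : CoTSp p :=
  (NormedSpace.fromTangentSpace (𝕜 := ℝ) (f p)).toContinuousLinearMap ∘L
    mfderiv 𝓘(ℝ, JetCoord n k) 𝓘(ℝ, ℝ) f p

/-- The tangent map `T ρ^k_r` at `p`. -/
def projT {r : ℕ} (h : r ≤ k) (p : HOTangent n k Q) : TSp p →L[ℝ] TSp (proj h p) :=
  mfderiv 𝓘(ℝ, JetCoord n k) 𝓘(ℝ, JetCoord n r) (proj h) p

/-- The velocity at `t = 0` of the canonical lifting of `σ` to `T^k Q`. -/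
def liftVelocity (k : ℕ) (σ : Curve n Q) : TSp (lift k σ 0) :=
  mfderiv 𝓘(ℝ, ℝ) 𝓘(ℝ, JetCoord n k) (lift k σ) 0 (1 : ℝ)

theorem liftVelocity_eq (σ : Curve n Q) :
    liftVelocity k σ = fun i : Fin (k + 1) => derivIn (σ 0) σ 0 (i + 1) := by
  set c := chartAt (JetCoord n k) (lift k σ 0) with hc
  set x : Q := (lift k σ 0).base with hx
  have hx0 : x = σ 0 := congrArg σ (zero_add 0)
  have hsrc : ∀ᶠ t in 𝓝 (0 : ℝ), σ t ∈ (chartAt (Coord n) x).source :=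
    σ.contMDiff.continuous.continuousAt.eventually_mem
      ((chartAt (Coord n) x).open_source.mem_nhds (by rw [hx0]; exact mem_chart_source _ _))
  have hcoord : ∀ t, σ t ∈ (chartAt (Coord n) x).source →
      c (lift k σ t) = fun i : Fin (k + 1) => derivIn x σ t i := by
    intro t ht
    change natCoord x (jet k (shift σ t)) = _
    rw [natCoord_jet (by change σ (0 + t) ∈ _; rwa [zero_add])]
    funext i
    exact derivIn_shift x σ t i
  have hev : (fun t => c (lift k σ t)) =ᶠ[𝓝 0] fun t => fun i : Fin (k + 1) => derivIn x σ t i :=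
    hsrc.mono hcoord
  have hder : HasDerivAt (fun t => fun i : Fin (k + 1) => derivIn x σ t i)
      (fun i : Fin (k + 1) => derivIn x σ 0 (i + 1)) 0 := by
    refine hasDerivAt_pi.2 fun i => ?_
    have hsm := contDiffAt_chart_comp (σ := σ) hsrc.self_of_nhds
    have : DifferentiableAt ℝ (fun t => derivIn x σ t i) 0 := by
      have h3 : DifferentiableAt ℝ
          (iteratedFDeriv ℝ i fun s => chartAt (Coord n) x (σ s)) 0 :=
        (hsm.iteratedFDeriv_right (m := ∞) (i := i) le_rfl).differentiableAt (by simp)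
      exact (ContinuousMultilinearMap.apply ℝ (fun _ : Fin i => ℝ) (Coord n)
        fun _ => 1).differentiableAt.comp 0 h3
    have h2 := this.hasDerivAt
    unfold derivIn at h2 ⊢
    rwa [iteratedDeriv_succ]
  have hder' := hder.congr_of_eventuallyEq hev
  have hcont : ContinuousAt (lift k σ) 0 := by
    rw [c.continuousAt_iff_continuousAt_comp_left]
    · exact hder'.continuousAt
    · filter_upwards [hsrc] with t ht
      change σ (0 + t) ∈ (chartAt (Coord n) x).source
      rwa [zero_add]
  have hmd : MDifferentiableAt 𝓘(ℝ, ℝ) 𝓘(ℝ, JetCoord n k) (lift k σ) 0 := by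
    refine mdifferentiableAt_iff _ _ |>.2 ⟨hcont, ?_⟩
    exact hder'.differentiableAt.differentiableWithinAt
  unfold liftVelocity
  rw [hmd.mfderiv]
  have h4 : fderivWithin ℝ (fun t => c (lift k σ t)) (Set.range (id : ℝ → ℝ)) 0 1 =
      fun i : Fin (k + 1) => derivIn x σ 0 (i + 1) := by
    rw [Set.range_id, fderivWithin_univ]
    exact hder'.deriv
  rw [hx0] at h4
  exact h4

/-- The canonical injection `j_{r+1} : T^k Q → T(T^r Q)`, sending the jet of `σ` to the velocity at
`t = 0` of the canonical lifting of `σ` to `T^r Q`. -/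
def canInj {r : ℕ} (h : r + 1 ≤ k) (p : HOTangent n k Q) : TSp (proj (r.le_succ.trans h) p) :=
  Quotient.lift (s := jetSetoid n k Q) (fun σ : Curve n Q => (liftVelocity r σ : JetCoord n r))
    (by
      intro σ τ hστ
      obtain ⟨h0, h1⟩ := hστ
      simp only [liftVelocity_eq]
      funext i
      rw [h1 _ (by omega), h0]) p

/-- The connecting map `h_{k-r+1}` followed by the inclusion of the vertical subbundle, at `p`:
`(v_0, …, v_{k-r}) ↦ (0, …, 0, (r!/0!) v_0, …, (k!/(k-r)!) v_{k-r})`. -/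
def connecting {r : ℕ} (h : r ≤ k) (p : HOTangent n k Q) :
    TSp (proj (k.sub_le r) p) →L[ℝ] TSp p :=
  show JetCoord n (k - r) →L[ℝ] JetCoord n k from
  ContinuousLinearMap.pi fun i => if hi : r ≤ (i : ℕ) then
    (((i : ℕ).factorial : ℝ) / (((i : ℕ) - r).factorial : ℝ)) •
      ContinuousLinearMap.proj (⟨(i : ℕ) - r, by omega⟩ : Fin (k - r + 1))
    else 0

/-- The `r`-th canonical vector field `Δ_r` on `T^k Q`. -/
def canField {r : ℕ} (h1 : 1 ≤ r) (h : r ≤ k) (p : HOTangent n k Q) : TSp p :=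
  connecting h p (canInj (r := k - r) (by omega) p)

/-- The `r`-th vertical endomorphism `J_r` of `T(T^k Q)`. -/
def vertEndo {r : ℕ} (h : r ≤ k) (p : HOTangent n k Q) : TSp p →L[ℝ] TSp p :=
  connecting h p ∘L projT (k.sub_le r) p

/-- Differential `1`-forms on `T^k Q`. -/
abbrev OneForm (n k : ℕ) (Q : Type*) [TopologicalSpace Q] [ChartedSpace (Coord n) Q]
    [IsManifold (𝓡 n) ∞ Q] := ∀ p : HOTangent n k Q, CoTSp p

/-- The pull-back `(ρ^k_r)^* θ` of a `1`-form. -/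
def pullForm {r : ℕ} (h : r ≤ k) (θ : OneForm n r Q) : OneForm n k Q :=
  fun p => θ (proj h p) ∘L projT h p

/-- The vertical differential of a function, `d_{J_r} f = i(J_r) df = df ∘ J_r`. -/
def vertDiff {r : ℕ} (h : r ≤ k) (f : HOTangent n k Q → ℝ) : OneForm n k Q :=
  fun p => dFun f p ∘L vertEndo h p

/-- The derivative `Δ_r(f)`. -/
def canFieldApply {r : ℕ} (h1 : 1 ≤ r) (h : r ≤ k) (f : HOTangent n k Q → ℝ) :
    HOTangent n k Q → ℝ :=
  fun p => dFun f p (canField h1 h p)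

/-- Tulczyjew's derivation on functions. -/
def dT (f : HOTangent n k Q → ℝ) : HOTangent n (k + 1) Q → ℝ :=
  fun p => dFun f (proj k.le_succ p) (canInj le_rfl p)

/-- The differential `dq_i^A` of a natural coordinate over the chart of `Q` at `x`. -/
def dq (x : Q) (i : Fin (k + 1)) (A : Fin n) : OneForm n k Q :=
  dFun fun p => natCoord x p i A

/-- The coordinate vector field `∂/∂q_i^A` over the chart of `Q` at `x`. -/
def partialQ (x : Q) (i : Fin (k + 1)) (A : Fin n) (p : HOTangent n k Q) : TSp p :=
  mfderiv 𝓘(ℝ, JetCoord n k) 𝓘(ℝ, JetCoord n k) (jetChart (n := n) (k := k) x).symm (natCoord x p)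
    (Pi.single i (EuclideanSpace.single A (1 : ℝ)) : JetCoord n k)

/-- Tulczyjew's derivation on `1`-forms, `d_T(a dq_i^A) = d_T(a) dq_i^A + a dq_{i+1}^A`. At `p`,
the form `θ = ∑ a_i^A dq_i^A`, `a_i^A = θ(∂/∂q_i^A)`, is expanded in natural coordinates over the
chart of `Q` at `β(p)`. -/
def dTForm (θ : OneForm n k Q) : OneForm n (k + 1) Q := fun p =>
  ∑ i : Fin (k + 1), ∑ A : Fin n,
    (dT (fun p' => θ p' (partialQ p.base i A p')) p • dq p.base i.castSucc A p +
      θ (proj k.le_succ p) (partialQ p.base i A (proj k.le_succ p)) • dq p.base i.succ A p)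

/-- The iterates `d_T^s` on functions. -/
def dTIter (f : HOTangent n k Q → ℝ) : (s : ℕ) → HOTangent n (k + s) Q → ℝ
  | 0 => f
  | s + 1 => dT (dTIter f s)

/-- The iterates `d_T^s` on `1`-forms. -/
def dTFormIter (θ : OneForm n k Q) : (s : ℕ) → OneForm n (k + s) Q
  | 0 => θ
  | s + 1 => dTForm (dTFormIter θ s)

end Geometry

section Dynamics

variable {n k : ℕ} {Q : Type*} [TopologicalSpace Q] [ChartedSpace (Coord n) Q]
  [IsManifold (𝓡 n) ∞ Q]

/-- The Lagrangian `1`-form `θ_L = ∑_{r=1}^k (-1)^{r-1} (1/r!) d_T^{r-1} d_{J_r} L` on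
`T^{2k-1} Q`; the summation index is `s = r - 1`. -/
def lagrangianForm (L : HOTangent n k Q → ℝ) : OneForm n (2 * k - 1) Q := fun p =>
  ∑ s : Fin k, ((-1 : ℝ) ^ (s : ℕ) / (((s : ℕ) + 1).factorial : ℝ)) •
    pullForm (by omega) (dTFormIter (vertDiff (r := s + 1) (by omega) L) s) p

/-- The Lagrangian energy
`E_L = ∑_{r=1}^k (-1)^{r-1} (1/r!) d_T^{r-1} (Δ_r(L)) - L` on `T^{2k-1} Q`; the summation index is
`s = r - 1`. -/
def lagrangianEnergy (hk : 1 ≤ k) (L : HOTangent n k Q → ℝ) (p : HOTangent n (2 * k - 1) Q) : ℝ :=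
  ∑ s : Fin k, (-1 : ℝ) ^ (s : ℕ) / (((s : ℕ) + 1).factorial : ℝ) *
    dTIter (canFieldApply (r := s + 1) (by omega) (by omega) L) s (proj (by omega) p) -
  L (proj (by omega) p)

/-- The defining property of the value at `p` of the Legendre–Ostrogradsky map:
`θ_L(u) = ⟨T ρ(u), α⟩` for all `u ∈ T_p(T^{2k-1} Q)`. -/
def IsLegendreValue (L : HOTangent n k Q → ℝ) (p : HOTangent n (2 * k - 1) Q)
    (α : CoTSp (proj (show k - 1 ≤ 2 * k - 1 by omega) p)) : Prop :=
  ∀ u : TSp p, lagrangianForm L p u = α (projT (by omega) p u)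

open Classical in
/-- The Legendre–Ostrogradsky map `FL : T^{2k-1} Q → T*(T^{k-1} Q)`, a covector over `ρ(p)`. -/
def legendreMap (L : HOTangent n k Q → ℝ) (p : HOTangent n (2 * k - 1) Q) :
    CoTSp (proj (show k - 1 ≤ 2 * k - 1 by omega) p) :=
  if h : ∃ α, IsLegendreValue L p α then h.choose else 0

variable (n k Q) in
/-- The unified phase space `W = T^{2k-1} Q ×_{T^{k-1} Q} T*(T^{k-1} Q)`. -/
structure UnifiedSpace where
  /-- The projection to `T^{2k-1} Q`. -/
  pr₁ : HOTangent n (2 * k - 1) Q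
  /-- The covector at `ρ(pr₁)`. -/
  covector : CoTSp (proj (show k - 1 ≤ 2 * k - 1 by omega) pr₁)

/-- The coupling function `C(p, α) = ⟨α | j_k(p)⟩`. -/
def coupling (hk : 1 ≤ k) (w : UnifiedSpace n k Q) : ℝ :=
  w.covector (canInj (r := k - 1) (by omega) w.pr₁)

/-- The unified Hamiltonian `H = C - (ρ^{2k-1}_k ∘ pr₁)^* L`. -/
def unifiedHamiltonian (hk : 1 ≤ k) (L : HOTangent n k Q → ℝ) (w : UnifiedSpace n k Q) : ℝ :=
  coupling hk w - L (proj (by omega) w.pr₁)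

/-- The submanifold `W_o ⊆ W`, the graph of the Legendre–Ostrogradsky map. -/
def legendreGraph (L : HOTangent n k Q → ℝ) : Set (UnifiedSpace n k Q) :=
  {w | w.covector = legendreMap L w.pr₁}

end Dynamics

end HigherOrder

end

noncomputable section

namespace HigherOrder

/-! ### Calculus of iterated derivatives of curves -/

section Calculus

variable {E : Type*} [NormedAddCommGroup E] [NormedSpace ℝ E]

/-! Let `σ` be a curve with jet `p`, and let `u` be the velocity of its lift to `T^{2k-1}Q`. The
projection of `u` to `T(T^{k-1}Q)` is `j_k(p)`, so the coupling at `(p, FL(p))` is `θ_L(u)`, and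
everything reduces to `θ_L(u) = E_L(p) + L` (`lagrangianForm_velocity`). Two facts give this.
Applying `J_r` to the velocity yields `Δ_r`, hence `d_{J_r}L` contracted with the velocity is
`Δ_r(L)` (`canFieldApply_lift`). And `d_T` is the time derivative along lifted curves, for functions
and for forms, so contraction with the velocity commutes with `d_T` (`dTFormIter_velocity`).
Uniqueness of `E` is immediate, since the graph has a point over every `p`.

That `FL` exists is a matter of order: `d_{J_r}L` is semibasic over `T^{k-r}Q`, each `d_T` raises
the order by one, so every term of `θ_L` is semibasic over `T^{k-1}Q` (`lagrangianForm_eq_zero`) and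
descends along the projection.

Independence of charts comes from representing tangent vectors to `T^mQ` as jets of vector fields
`v` along a curve (`jetVec`). Such a prolongation is intrinsic (`jetVec_trans`). In these terms
`J_r` is multiplication of `v` by `(s - t)^r`, and `d_T θ` evaluated on the prolongation of `v` is
the time derivative of `θ` evaluated on it. Both descriptions are free of charts, and they turn
coordinate formulas valid in one chart into formulas valid in all. -/

theorem hasDerivAt_iteratedDeriv {v : ℝ → E} {t : ℝ} (hv : ContDiffAt ℝ ∞ v t) (i : ℕ) :
    HasDerivAt (iteratedDeriv i v) (iteratedDeriv (i + 1) v t) t := by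
  have h : DifferentiableAt ℝ (iteratedFDeriv ℝ i v) t :=
    (hv.iteratedFDeriv_right (m := ∞) (i := i) le_rfl).differentiableAt (by simp)
  have h' : DifferentiableAt ℝ (iteratedDeriv i v) t :=
    (ContinuousMultilinearMap.apply ℝ (fun _ : Fin i => ℝ) E
      fun _ => 1).differentiableAt.comp t h
  rw [iteratedDeriv_succ]
  exact h'.hasDerivAt

theorem hasDerivAt_jet {v : ℝ → E} {t : ℝ} (hv : ContDiffAt ℝ ∞ v t) (m : ℕ) :
    HasDerivAt (fun s => fun i : Fin (m + 1) => iteratedDeriv i v s)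
      (fun i : Fin (m + 1) => iteratedDeriv (i + 1) v t) t :=
  hasDerivAt_pi.2 fun i => hasDerivAt_iteratedDeriv hv i

/-- Jets of `s ↦ (s - t) ^ r • v s` at `t`. -/
theorem iteratedDeriv_sub_pow_smul {v : ℝ → E} {t : ℝ} (hv : ContDiffAt ℝ ∞ v t) (r j : ℕ) :
    iteratedDeriv j (fun s => (s - t) ^ r • v s) t =
      if r ≤ j then ((j.factorial : ℝ) / ((j - r).factorial : ℝ)) • iteratedDeriv (j - r) v t
      else 0 := by
  have hp : ∀ i, iteratedDeriv i (fun s : ℝ => (s - t) ^ r) t =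
      if i = r then (r.factorial : ℝ) else 0 := by
    intro i
    have := congrFun (iteratedDeriv_comp_sub_const i (fun s : ℝ => s ^ r) t) t
    rw [this, sub_self, iteratedDeriv_fun_pow_zero]
    split_ifs <;> simp
  have h := iteratedDerivWithin_smul (n := j) (Set.mem_univ t) uniqueDiffOn_univ
    (f := fun s : ℝ => (s - t) ^ r) (g := v)
    (ContDiffAt.contDiffWithinAt (by fun_prop))
    (hv.of_le (by exact_mod_cast le_top)).contDiffWithinAt
  simp only [iteratedDerivWithin_univ, hp] at h
  change iteratedDeriv j ((fun s : ℝ => (s - t) ^ r) • v) t = _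
  rw [h]
  split_ifs with hr
  -- In Leibniz's formula only the term with exactly `r` derivatives on the power survives at `t`,
  -- and `choose j r * r! = j! / (j - r)!`.
  · rw [Finset.sum_eq_single r]
    · rw [if_pos rfl, ← Nat.cast_smul_eq_nsmul ℝ, smul_smul, Nat.cast_choose ℝ hr]
      congr 1
      field_simp
    · intro i _ hi
      simp [hi]
    · intro hi
      exact absurd (Finset.mem_range.2 (by omega)) hi
  · refine Finset.sum_eq_zero fun i hi => ?_
    rw [if_neg (by have := Finset.mem_range.1 hi; omega)]
    simp

/-- Derivatives with respect to a parameter commute with iterated derivatives. -/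
theorem hasDerivAt_iteratedDeriv_param (i : ℕ) {G : ℝ × ℝ → E} {e t : ℝ}
    (hG : ContDiffAt ℝ ∞ G (e, t)) :
    HasDerivAt (fun e' => iteratedDeriv i (fun s => G (e', s)) t)
      (iteratedDeriv i (fun s => fderiv ℝ G (e, s) (1, 0)) t) e := by
  induction i generalizing G with
  | zero =>
    simp only [iteratedDeriv_zero]
    have h := (hG.differentiableAt (by simp)).hasFDerivAt
    exact h.comp_hasDerivAt (f := fun e' : ℝ => (e', t)) e
      ((hasDerivAt_id e).prodMk (hasDerivAt_const e t))
  | succ i ih =>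
    have hd : ContDiffAt ℝ ∞ (fderiv ℝ G) (e, t) := hG.fderiv_right (m := ∞) le_rfl
    have hG' : ContDiffAt ℝ ∞ (fun p => fderiv ℝ G p (0, 1)) (e, t) :=
      hd.clm_apply contDiffAt_const
    -- Smoothness of order `∞` at a point gives each finite order on a neighbourhood; order 2 is
    -- what the symmetry of second derivatives needs.
    have hev2 : ∀ᶠ p in 𝓝 (e, t), ContDiffAt ℝ 2 G p :=
      (hG.of_le ENat.LEInfty.out).eventually (by simp)
    have hev : ∀ᶠ p in 𝓝 e ×ˢ 𝓝 t, ContDiffAt ℝ 2 G p := by rwa [← nhds_prod_eq]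
    have h := ih hG'
    have hder : ∀ e' s, ContDiffAt ℝ 2 G (e', s) →
        deriv (fun s => G (e', s)) s = fderiv ℝ G (e', s) (0, 1) := by
      intro e' s hs
      exact ((hs.differentiableAt (by simp)).hasFDerivAt.comp_hasDerivAt (f := fun s : ℝ => (e', s))
        s ((hasDerivAt_const s e').prodMk (hasDerivAt_id s))).deriv
    have hfun : (fun e' => iteratedDeriv (i + 1) (fun s => G (e', s)) t) =ᶠ[𝓝 e]
        fun e' => iteratedDeriv i (fun s => fderiv ℝ G (e', s) (0, 1)) t := by
      filter_upwards [hev.curry] with e' he'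
      rw [iteratedDeriv_succ']
      refine Filter.EventuallyEq.iteratedDeriv_eq i ?_
      filter_upwards [he'] with s hs using hder e' s hs
    -- The induction hypothesis, applied to `∂G/∂s`, yields the mixed derivative in the other order;
    -- symmetry of the second derivative identifies the two.
    have hval : iteratedDeriv (i + 1) (fun s => fderiv ℝ G (e, s) (1, 0)) t =
        iteratedDeriv i (fun s => fderiv ℝ (fun p => fderiv ℝ G p (0, 1)) (e, s) (1, 0)) t := by
      rw [iteratedDeriv_succ']
      refine Filter.EventuallyEq.iteratedDeriv_eq i ?_
      filter_upwards [hev.curry.self_of_nhds] with s hs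
      have hs1 : DifferentiableAt ℝ (fderiv ℝ G) (e, s) :=
        (hs.fderiv_right (m := 1) le_rfl).differentiableAt (by simp)
      have h1 : HasDerivAt (fun s => fderiv ℝ G (e, s) (1, 0))
          (fderiv ℝ (fderiv ℝ G) (e, s) (0, 1) (1, 0)) s := by
        have := hs1.hasFDerivAt.comp_hasDerivAt (f := fun s : ℝ => (e, s))
          s ((hasDerivAt_const s e).prodMk (hasDerivAt_id s))
        simpa using this.clm_apply (hasDerivAt_const s ((1 : ℝ), (0 : ℝ)))
      rw [h1.deriv, (hs.isSymmSndFDerivAt (by simp)).eq]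
      rw [fderiv_clm_apply hs1 (by fun_prop)]
      simp
    rw [hval]
    exact h.congr_of_eventuallyEq hfun

end Calculus

/-! ### Changes of natural coordinates and prolonged vector fields -/

section Transition

variable {n k : ℕ} {Q : Type*} [TopologicalSpace Q] [ChartedSpace (Coord n) Q]

theorem isOpen_trans_source (x y : Q) : IsOpen {q | q ∈ (chartAt (Coord n) x).target ∧
    (chartAt (Coord n) x).symm q ∈ (chartAt (Coord n) y).source} :=
  ((chartAt (Coord n) x).symm.trans (chartAt (Coord n) y)).open_source

variable [IsManifold (𝓡 n) ∞ Q]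

/-- Faà di Bruno's formula read backwards: it replaces the explicit sum defining `transJet` by the
jet of a composed curve, which can then be differentiated through families of curves. -/
theorem transJet_apply {x y : Q} {q : ℝ → Coord n} {t : ℝ} (hq : ContDiffAt ℝ ∞ q t)
    (hx : q t ∈ (chartAt (Coord n) x).target)
    (hy : (chartAt (Coord n) x).symm (q t) ∈ (chartAt (Coord n) y).source) :
    transJet (k := k) x y (fun i => iteratedDeriv i q t) =
      fun i : Fin (k + 1) => iteratedDeriv i (fun s => trans x y (q s)) t := by
  funext i
  refine Eq.trans ?_ (iteratedDeriv_vcomp_eq_sum_orderedFinpartition (i := i)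
    (contDiffAt_trans hx hy) hq (by exact_mod_cast le_top)).symm
  refine Finset.sum_congr rfl fun c _ => ?_
  simp only [Fin.val_zero, iteratedDeriv_zero]
  congr 1
  funext j
  rw [Fin.val_ofNat, Nat.mod_eq_of_lt]
  exact Nat.lt_succ_iff.2 ((c.partSize_le j).trans (Nat.lt_succ_iff.1 i.2))

/-- The derivative of a change of natural coordinates, applied to the jet of `w`, is the jet of
the image of `w` under the derivative of the change of charts. -/
theorem fderiv_transJet {x y : Q} {q w : ℝ → Coord n} {t : ℝ} (hq : ContDiffAt ℝ ∞ q t)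
    (hw : ContDiffAt ℝ ∞ w t) (hx : q t ∈ (chartAt (Coord n) x).target)
    (hy : (chartAt (Coord n) x).symm (q t) ∈ (chartAt (Coord n) y).source)
    (hd : DifferentiableAt ℝ (transJet (k := k) x y) (fun i => iteratedDeriv i q t)) :
    fderiv ℝ (transJet (k := k) x y) (fun i => iteratedDeriv i q t)
      (fun i => iteratedDeriv i w t) =
      fun i : Fin (k + 1) => iteratedDeriv i (fun s => fderiv ℝ (trans x y) (q s) (w s)) t := by
  set V : JetCoord n k := fun i => iteratedDeriv i w t with hV
  set X : JetCoord n k := fun i => iteratedDeriv i q t with hX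
  have hline : HasDerivAt (fun e : ℝ => X + e • V) V 0 := by
    simpa using ((hasDerivAt_id (0 : ℝ)).smul_const V).const_add X
  have h1 : HasDerivAt (fun e : ℝ => transJet (k := k) x y (X + e • V))
      (fderiv ℝ (transJet (k := k) x y) X V) 0 := by
    have hd' : HasFDerivAt (transJet (k := k) x y) (fderiv ℝ (transJet (k := k) x y) X)
        (X + (0 : ℝ) • V) := by simpa using hd.hasFDerivAt
    exact hd'.comp_hasDerivAt (f := fun e : ℝ => X + e • V) 0 hline
  -- The line `X + e • V` consists of the jets of the curves `q + e • w`, so its image under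
  -- `transJet` consists of the jets of `G (e, ·)`; the derivative in `e` then passes under the time
  -- derivatives.
  let G : ℝ × ℝ → Coord n := fun p => trans x y (q p.2 + p.1 • w p.2)
  have hin : ContDiffAt ℝ ∞ (fun p : ℝ × ℝ => q p.2 + p.1 • w p.2) (0, t) := by
    have h2 : ContDiffAt ℝ ∞ (fun p : ℝ × ℝ => q p.2) (0, t) := hq.comp (0, t) contDiffAt_snd
    have h3 : ContDiffAt ℝ ∞ (fun p : ℝ × ℝ => w p.2) (0, t) := hw.comp (0, t) contDiffAt_snd
    exact h2.add (contDiffAt_fst.smul h3)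
  have hG : ContDiffAt ℝ ∞ G (0, t) := by
    refine ContDiffAt.comp (g := trans x y) (0, t) ?_ hin
    simpa using contDiffAt_trans hx hy
  have h2 : HasDerivAt (fun e : ℝ => transJet (k := k) x y (X + e • V))
      (fun i : Fin (k + 1) => iteratedDeriv i (fun s => fderiv ℝ G (0, s) (1, 0)) t) 0 := by
    have h3 := hasDerivAt_pi.2 fun i : Fin (k + 1) => hasDerivAt_iteratedDeriv_param i hG
    refine h3.congr_of_eventuallyEq ?_
    have hmem : ∀ᶠ e : ℝ in 𝓝 0, q t + e • w t ∈ {q | q ∈ (chartAt (Coord n) x).target ∧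
        (chartAt (Coord n) x).symm q ∈ (chartAt (Coord n) y).source} := by
      refine ContinuousAt.eventually_mem (f := fun e : ℝ => q t + e • w t) (by fun_prop) ?_
      exact (isOpen_trans_source x y).mem_nhds (by simpa using ⟨hx, hy⟩)
    filter_upwards [hmem] with e he
    have hqe : ContDiffAt ℝ ∞ (fun s => q s + e • w s) t := hq.add (hw.const_smul e)
    rw [← transJet_apply hqe he.1 he.2]
    congr 1
    funext i
    have hi : ((i : ℕ) : ℕ∞ω) ≤ ∞ := by exact_mod_cast le_top
    change iteratedDeriv i q t + e • iteratedDeriv i w t = iteratedDeriv i (q + e • w) t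
    have h4 : ContDiffAt ℝ (i : ℕ) (e • w) t := (hw.of_le hi).const_smul e
    rw [iteratedDeriv_add (hq.of_le hi) h4, iteratedDeriv_const_smul_field]
  rw [h1.unique h2]
  funext i
  refine Filter.EventuallyEq.iteratedDeriv_eq i ?_
  have hmem : ∀ᶠ s in 𝓝 t, q s ∈ {q | q ∈ (chartAt (Coord n) x).target ∧
      (chartAt (Coord n) x).symm q ∈ (chartAt (Coord n) y).source} :=
    hq.continuousAt.eventually_mem ((isOpen_trans_source x y).mem_nhds ⟨hx, hy⟩)
  have hin' : ∀ᶠ s in 𝓝 t, DifferentiableAt ℝ G (0, s) := by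
    have : ∀ᶠ p in 𝓝 (0, t), ContDiffAt ℝ 1 G p :=
      (hG.of_le ENat.LEInfty.out).eventually (by simp)
    rw [nhds_prod_eq] at this
    exact this.curry.self_of_nhds.mono fun s hs => hs.differentiableAt (by simp)
  filter_upwards [hmem, hin'] with s hs hs'
  have h4 : HasDerivAt (fun e : ℝ => G (e, s)) (fderiv ℝ G (0, s) (1, 0)) 0 :=
    hs'.hasFDerivAt.comp_hasDerivAt (f := fun e' : ℝ => (e', s)) 0
      ((hasDerivAt_id 0).prodMk (hasDerivAt_const 0 s))
  have h5 : HasDerivAt (fun e : ℝ => G (e, s)) (fderiv ℝ (trans x y) (q s) (w s)) 0 := by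
    have hl : HasDerivAt (fun e : ℝ => q s + e • w s) (w s) 0 := by
      simpa using ((hasDerivAt_id (0 : ℝ)).smul_const (w s)).const_add (q s)
    have hd' : HasFDerivAt (trans x y) (fderiv ℝ (trans x y) (q s)) (q s + (0 : ℝ) • w s) := by
      simpa using ((contDiffAt_trans hs.1 hs.2).differentiableAt (by simp)).hasFDerivAt
    exact hd'.comp_hasDerivAt (f := fun e : ℝ => q s + e • w s) 0 hl
  exact h4.unique h5

end Transition

/-! ### Natural charts and tangent vectors in natural coordinates -/

section Charts

variable {n k : ℕ} {Q : Type*} [TopologicalSpace Q] [ChartedSpace (Coord n) Q]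

theorem base_proj {r : ℕ} (h : r ≤ k) (p : HOTangent n k Q) : (proj h p).base = p.base := by
  obtain ⟨σ, rfl⟩ := jet_surj p
  rfl

theorem base_lift (σ : Curve n Q) (t : ℝ) : (lift k σ t).base = σ t :=
  congrArg σ (zero_add t)

theorem proj_lift {r : ℕ} (h : r ≤ k) (σ : Curve n Q) (t : ℝ) :
    proj h (lift k σ t) = lift r σ t := rfl

theorem lift_zero (σ : Curve n Q) : lift k σ 0 = jet k σ := by
  unfold lift shift
  congr 1
  ext s
  simp

theorem exists_lift (p : HOTangent n k Q) : ∃ σ : Curve n Q, p = lift k σ 0 := by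
  obtain ⟨σ, rfl⟩ := jet_surj p
  exact ⟨σ, (lift_zero σ).symm⟩

theorem eventually_mem_source {x : Q} {σ : Curve n Q} {t : ℝ}
    (hx : σ t ∈ (chartAt (Coord n) x).source) :
    ∀ᶠ s in 𝓝 t, σ s ∈ (chartAt (Coord n) x).source :=
  σ.contMDiff.continuous.continuousAt.eventually_mem ((chartAt (Coord n) x).open_source.mem_nhds hx)

variable [IsManifold (𝓡 n) ∞ Q]

/-- The natural chart of `T^k Q` over the chart of `Q` at `x`, as an open partial
homeomorphism. -/
def natChart (k : ℕ) (x : Q) : OpenPartialHomeomorph (HOTangent n k Q) (JetCoord n k) :=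
  -- The constant jet at `x` has base `x`, so its preferred chart is definitionally built from
  -- `jetChart x`.
  chartAt (JetCoord n k) (jet k (ContMDiffMap.const x) : HOTangent n k Q)

theorem natChart_mem_maximalAtlas (x : Q) :
    natChart k x ∈ IsManifold.maximalAtlas 𝓘(ℝ, JetCoord n k) ∞ (HOTangent n k Q) :=
  IsManifold.chart_mem_maximalAtlas _

theorem natCoord_mem_target {x : Q} {p : HOTangent n k Q}
    (hx : p.base ∈ (chartAt (Coord n) x).source) : natCoord x p ∈ (natChart k x).target :=
  (natChart k x).map_source hx

theorem jetChart_symm_natCoord {x : Q} {p : HOTangent n k Q}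
    (hx : p.base ∈ (chartAt (Coord n) x).source) : (jetChart x).symm (natCoord x p) = p :=
  (natChart k x).left_inv hx

theorem natCoord_jetChart_symm {x : Q} {q : JetCoord n k}
    (hq : q 0 ∈ (chartAt (Coord n) x).target) :
    natCoord x ((jetChart x).symm q : HOTangent n k Q) = q :=
  (natChart k x).right_inv hq

theorem base_jetChart_symm {x : Q} {q : JetCoord n k}
    (hq : q 0 ∈ (chartAt (Coord n) x).target) :
    ((jetChart x).symm q : HOTangent n k Q).base ∈ (chartAt (Coord n) x).source :=
  (natChart k x).map_target hq

/-- The truncation of jet coordinates. -/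
def truncate (n : ℕ) {r k : ℕ} (h : r ≤ k) : JetCoord n k →L[ℝ] JetCoord n r :=
  ContinuousLinearMap.pi fun i => ContinuousLinearMap.proj (Fin.castLE (Nat.succ_le_succ h) i)

@[simp] theorem truncate_apply {r : ℕ} (h : r ≤ k) (q : JetCoord n k) (i : Fin (r + 1)) :
    truncate n h q i = q (Fin.castLE (Nat.succ_le_succ h) i) := rfl

theorem natCoord_proj {r : ℕ} (h : r ≤ k) {x : Q} {p : HOTangent n k Q}
    (hx : p.base ∈ (chartAt (Coord n) x).source) :
    natCoord x (proj h p) = truncate n h (natCoord x p) := by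
  obtain ⟨σ, rfl⟩ := jet_surj p
  change natCoord x (jet r σ) = _
  rw [natCoord_jet hx, natCoord_jet hx]
  rfl

theorem natCoord_lift {x : Q} {σ : Curve n Q} {t : ℝ}
    (hx : σ t ∈ (chartAt (Coord n) x).source) :
    natCoord x (lift k σ t) = fun i : Fin (k + 1) => derivIn x σ t i := by
  unfold lift
  rw [natCoord_jet (by change σ (0 + t) ∈ _; rwa [zero_add])]
  funext i
  exact derivIn_shift x σ t i

theorem isOpen_base_source (x : Q) :
    IsOpen {p : HOTangent n k Q | p.base ∈ (chartAt (Coord n) x).source} :=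
  (natChart k x).open_source

theorem contMDiffOn_natCoord (x : Q) : ContMDiffOn 𝓘(ℝ, JetCoord n k) 𝓘(ℝ, JetCoord n k) ∞
    (natCoord x) {p : HOTangent n k Q | p.base ∈ (chartAt (Coord n) x).source} :=
  contMDiffOn_of_mem_maximalAtlas (natChart_mem_maximalAtlas x)

theorem contMDiffOn_jetChart_symm (x : Q) : ContMDiffOn 𝓘(ℝ, JetCoord n k) 𝓘(ℝ, JetCoord n k) ∞
    (jetChart (n := n) (k := k) x).symm {q : JetCoord n k | q 0 ∈ (chartAt (Coord n) x).target} :=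
  contMDiffOn_symm_of_mem_maximalAtlas (natChart_mem_maximalAtlas x)

theorem isOpen_target (x : Q) : IsOpen {q : JetCoord n k | q 0 ∈ (chartAt (Coord n) x).target} :=
  (natChart k x).open_target

theorem contMDiff_proj {r : ℕ} (h : r ≤ k) :
    ContMDiff 𝓘(ℝ, JetCoord n k) 𝓘(ℝ, JetCoord n r) ∞ (proj (n := n) (Q := Q) h) := by
  intro p
  have hp : p.base ∈ (chartAt (Coord n) p.base).source := mem_chart_source _ _
  have h1 : ContMDiffOn 𝓘(ℝ, JetCoord n k) 𝓘(ℝ, JetCoord n r) ∞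
      (fun p' => (jetChart p.base).symm (truncate n h (natCoord p.base p')))
      {p' : HOTangent n k Q | p'.base ∈ (chartAt (Coord n) p.base).source} := by
    refine (contMDiffOn_jetChart_symm p.base).comp
      ((truncate n h).contDiff.contMDiff.comp_contMDiffOn (contMDiffOn_natCoord p.base)) ?_
    intro p' hp'
    exact natCoord_mem_target hp'
  refine (h1.congr fun p' hp' => ?_).contMDiffAt ((isOpen_base_source _).mem_nhds hp)
  rw [← natCoord_proj h hp', jetChart_symm_natCoord]
  rwa [base_proj]

theorem mdifferentiableAt_natCoord {x : Q} {p : HOTangent n k Q}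
    (hx : p.base ∈ (chartAt (Coord n) x).source) :
    MDifferentiableAt 𝓘(ℝ, JetCoord n k) 𝓘(ℝ, JetCoord n k) (natCoord x) p :=
  ((contMDiffOn_natCoord x).contMDiffAt ((isOpen_base_source x).mem_nhds hx)).mdifferentiableAt
    (by simp)

theorem mdifferentiableAt_jetChart_symm {x : Q} {q : JetCoord n k}
    (hq : q 0 ∈ (chartAt (Coord n) x).target) :
    MDifferentiableAt 𝓘(ℝ, JetCoord n k) 𝓘(ℝ, JetCoord n k) (jetChart x).symm q :=
  ((contMDiffOn_jetChart_symm x).contMDiffAt ((isOpen_target x).mem_nhds hq)).mdifferentiableAt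
    (by simp)

/-- The tangent vector with components `V` in the natural chart over the chart of `Q` at `x`. -/
def coordVec (x : Q) (p : HOTangent n k Q) : JetCoord n k →L[ℝ] TSp p :=
  mfderiv 𝓘(ℝ, JetCoord n k) 𝓘(ℝ, JetCoord n k) (jetChart (n := n) (k := k) x).symm (natCoord x p)

theorem partialQ_eq (x : Q) (i : Fin (k + 1)) (A : Fin n) (p : HOTangent n k Q) :
    partialQ x i A p = coordVec x p (Pi.single i (EuclideanSpace.single A (1 : ℝ))) := rfl

theorem hasMFDerivAt_jetChart_symm {x : Q} {p : HOTangent n k Q}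
    (hx : p.base ∈ (chartAt (Coord n) x).source) :
    HasMFDerivAt 𝓘(ℝ, JetCoord n k) 𝓘(ℝ, JetCoord n k) (jetChart (n := n) (k := k) x).symm
      (natCoord x p) (coordVec x p) :=
  (mdifferentiableAt_jetChart_symm (natCoord_mem_target hx)).hasMFDerivAt

/-- Differential of a map read in natural coordinates. -/
theorem hasFDerivAt_comp_jetChart_symm {F : Type*} [NormedAddCommGroup F] [NormedSpace ℝ F]
    {f : HOTangent n k Q → F} {x : Q} {p : HOTangent n k Q} {T : JetCoord n k →L[ℝ] F}
    (hx : p.base ∈ (chartAt (Coord n) x).source)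
    (hf : HasMFDerivAt 𝓘(ℝ, JetCoord n k) 𝓘(ℝ, F) f p T) :
    HasFDerivAt (fun q => f ((jetChart x).symm q))
      (T.comp (show JetCoord n k →L[ℝ] JetCoord n k from coordVec x p)) (natCoord x p) := by
  have h2 : HasMFDerivAt 𝓘(ℝ, JetCoord n k) 𝓘(ℝ, F) f ((jetChart x).symm (natCoord x p)) T := by
    rw [jetChart_symm_natCoord hx]
    exact hf
  exact (h2.comp _ (hasMFDerivAt_jetChart_symm hx)).hasFDerivAt

/-- Differential of a function read in natural coordinates. -/
theorem dFun_coordVec {f : HOTangent n k Q → ℝ} {x : Q} {p : HOTangent n k Q}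
    (hx : p.base ∈ (chartAt (Coord n) x).source)
    (hf : MDifferentiableAt 𝓘(ℝ, JetCoord n k) 𝓘(ℝ, ℝ) f p) (V : JetCoord n k) :
    dFun f p (coordVec x p V) = fderiv ℝ (fun q => f ((jetChart x).symm q)) (natCoord x p) V := by
  let T : JetCoord n k →L[ℝ] ℝ := mfderiv 𝓘(ℝ, JetCoord n k) 𝓘(ℝ, ℝ) f p
  have hT : HasMFDerivAt 𝓘(ℝ, JetCoord n k) 𝓘(ℝ, ℝ) f p T := hf.hasMFDerivAt
  rw [(hasFDerivAt_comp_jetChart_symm hx hT).fderiv]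
  rfl

theorem mfderiv_natCoord_coordVec {x : Q} {p : HOTangent n k Q} {T : JetCoord n k →L[ℝ] JetCoord n k}
    (hx : p.base ∈ (chartAt (Coord n) x).source)
    (hT : HasMFDerivAt 𝓘(ℝ, JetCoord n k) 𝓘(ℝ, JetCoord n k) (natCoord x) p T)
    (V : JetCoord n k) : T (coordVec x p V) = V := by
  have h2 : HasFDerivAt (fun q : JetCoord n k => natCoord x ((jetChart x).symm q : HOTangent n k Q))
      (ContinuousLinearMap.id ℝ (JetCoord n k)) (natCoord x p) := by
    refine (hasFDerivAt_id _).congr_of_eventuallyEq ?_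
    filter_upwards [(isOpen_target x).mem_nhds (natCoord_mem_target hx)] with q hq
    exact natCoord_jetChart_symm hq
  exact congrArg (fun T : JetCoord n k →L[ℝ] JetCoord n k => T V)
    ((hasFDerivAt_comp_jetChart_symm hx hT).unique h2)

/-- The natural chart over `p.base` is the preferred chart at `p`, so read in its own chart the
coordinate map is the identity near the point. -/
theorem hasMFDerivAt_natCoord_base (p : HOTangent n k Q) :
    HasMFDerivAt 𝓘(ℝ, JetCoord n k) 𝓘(ℝ, JetCoord n k) (natCoord p.base) p
      (ContinuousLinearMap.id ℝ (JetCoord n k)) := by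
  have hx : p.base ∈ (chartAt (Coord n) p.base).source := mem_chart_source _ _
  refine ⟨(mdifferentiableAt_natCoord hx).continuousAt, ?_⟩
  refine HasFDerivAt.hasFDerivWithinAt ?_
  refine (hasFDerivAt_id _).congr_of_eventuallyEq ?_
  filter_upwards [(isOpen_target p.base).mem_nhds (natCoord_mem_target hx)] with q hq
  exact natCoord_jetChart_symm hq

/-- In Mathlib's trivialisation, tangent vectors are given by their components in the preferred
chart. -/
@[simp] theorem coordVec_base (p : HOTangent n k Q) (V : JetCoord n k) :
    coordVec p.base p V = V :=
  mfderiv_natCoord_coordVec (mem_chart_source (Coord n) p.base) (hasMFDerivAt_natCoord_base p) V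

theorem hasMFDerivAt_proj {r : ℕ} (h : r ≤ k) (p : HOTangent n k Q) :
    HasMFDerivAt 𝓘(ℝ, JetCoord n k) 𝓘(ℝ, JetCoord n r) (proj h) p (projT h p) :=
  (((contMDiff_proj h) p).mdifferentiableAt (by simp)).hasMFDerivAt

/-- Over one chart of `Q` the projection is the linear truncation of coordinates; two expressions of
the same map near a point have the same derivative. -/
theorem projT_coordVec {r : ℕ} (h : r ≤ k) {x : Q} {p : HOTangent n k Q}
    (hx : p.base ∈ (chartAt (Coord n) x).source) (V : JetCoord n k) :
    projT h p (coordVec x p V) = coordVec x (proj h p) (truncate n h V) := by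
  have hpx : (proj h p).base ∈ (chartAt (Coord n) x).source := by rwa [base_proj]
  have h1 : HasMFDerivAt 𝓘(ℝ, JetCoord n k) 𝓘(ℝ, JetCoord n r)
      (fun q => proj h ((jetChart x).symm q : HOTangent n k Q)) (natCoord x p)
      ((show JetCoord n k →L[ℝ] JetCoord n r from projT h p).comp
        (show JetCoord n k →L[ℝ] JetCoord n k from coordVec x p)) := by
    refine HasMFDerivAt.comp (g := proj h) _ ?_ (hasMFDerivAt_jetChart_symm hx)
    rw [jetChart_symm_natCoord hx]
    exact hasMFDerivAt_proj h p
  have h2 : HasMFDerivAt 𝓘(ℝ, JetCoord n k) 𝓘(ℝ, JetCoord n r)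
      (fun q => ((jetChart x).symm (truncate n h q) : HOTangent n r Q)) (natCoord x p)
      ((show JetCoord n r →L[ℝ] JetCoord n r from coordVec x (proj h p)).comp (truncate n h)) := by
    refine HasMFDerivAt.comp (g := (jetChart (n := n) (k := r) x).symm) (f := truncate n h) _ ?_
      (truncate n h).hasFDerivAt.hasMFDerivAt
    rw [← natCoord_proj h hx]
    exact hasMFDerivAt_jetChart_symm hpx
  have h3 : (fun q => proj h ((jetChart x).symm q : HOTangent n k Q)) =ᶠ[𝓝 (natCoord x p)]
      (fun q => ((jetChart x).symm (truncate n h q) : HOTangent n r Q)) := by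
    filter_upwards [(isOpen_target x).mem_nhds (natCoord_mem_target hx)] with q hq
    have hb := base_jetChart_symm hq
    rw [← natCoord_jetChart_symm hq, ← natCoord_proj h hb, jetChart_symm_natCoord hb,
      jetChart_symm_natCoord (by rwa [base_proj])]
  exact congrArg (fun T : JetCoord n k →L[ℝ] JetCoord n r => T V)
    (hasMFDerivAt_unique h1 (h2.congr_of_eventuallyEq h3))

theorem transJet_eventuallyEq {x y : Q} {p : HOTangent n k Q}
    (hx : p.base ∈ (chartAt (Coord n) x).source) (hy : p.base ∈ (chartAt (Coord n) y).source) :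
    (fun q => natCoord y ((jetChart x).symm q : HOTangent n k Q)) =ᶠ[𝓝 (natCoord x p)]
      transJet x y := by
  have hc : ContinuousAt (jetChart (n := n) (k := k) x).symm (natCoord x p) :=
    (mdifferentiableAt_jetChart_symm (natCoord_mem_target hx)).continuousAt
  have hev := hc.eventually_mem ((isOpen_base_source y).mem_nhds
    (show (jetChart x).symm (natCoord x p) ∈ _ by rwa [jetChart_symm_natCoord hx]))
  filter_upwards [(isOpen_target x).mem_nhds (natCoord_mem_target hx), hev] with q hq hq'
  rw [natCoord_trans (base_jetChart_symm hq) hq', natCoord_jetChart_symm hq]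

theorem differentiableAt_transJet {x y : Q} {p : HOTangent n k Q}
    (hx : p.base ∈ (chartAt (Coord n) x).source) (hy : p.base ∈ (chartAt (Coord n) y).source) :
    DifferentiableAt ℝ (transJet (k := k) x y) (natCoord x p) :=
  (hasFDerivAt_comp_jetChart_symm hx (mdifferentiableAt_natCoord hy).hasMFDerivAt).differentiableAt.congr_of_eventuallyEq
    (transJet_eventuallyEq hx hy).symm

/-- Change of natural coordinates for tangent vectors. -/
theorem coordVec_trans {x y : Q} {p : HOTangent n k Q}
    (hx : p.base ∈ (chartAt (Coord n) x).source) (hy : p.base ∈ (chartAt (Coord n) y).source)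
    (V : JetCoord n k) :
    coordVec x p V = coordVec y p (fderiv ℝ (transJet x y) (natCoord x p) V) := by
  have h1 := hasMFDerivAt_jetChart_symm (k := k) hx
  have h2 : HasMFDerivAt 𝓘(ℝ, JetCoord n k) 𝓘(ℝ, JetCoord n k)
      (fun q => ((jetChart y).symm (transJet x y q) : HOTangent n k Q)) (natCoord x p)
      ((show JetCoord n k →L[ℝ] JetCoord n k from coordVec y p).comp
        (fderiv ℝ (transJet x y) (natCoord x p))) := by
    refine HasMFDerivAt.comp (g := (jetChart (n := n) (k := k) y).symm) (f := transJet x y) _ ?_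
      (differentiableAt_transJet hx hy).hasFDerivAt.hasMFDerivAt
    rw [← natCoord_trans hx hy]
    exact hasMFDerivAt_jetChart_symm hy
  have h3 : ((jetChart (n := n) (k := k) x).symm) =ᶠ[𝓝 (natCoord x p)]
      (fun q => ((jetChart y).symm (transJet x y q) : HOTangent n k Q)) := by
    have hc : ContinuousAt (jetChart (n := n) (k := k) x).symm (natCoord x p) :=
      (mdifferentiableAt_jetChart_symm (natCoord_mem_target hx)).continuousAt
    have hev := hc.eventually_mem ((isOpen_base_source y).mem_nhds
      (show (jetChart x).symm (natCoord x p) ∈ _ by rwa [jetChart_symm_natCoord hx]))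
    filter_upwards [transJet_eventuallyEq hx hy, hev] with q hq hq'
    rw [← hq, jetChart_symm_natCoord hq']
  exact congrArg (fun T : JetCoord n k →L[ℝ] JetCoord n k => T V)
    (hasMFDerivAt_unique h1 (h2.congr_of_eventuallyEq h3))

theorem dq_coordVec {x : Q} {p : HOTangent n k Q} (hx : p.base ∈ (chartAt (Coord n) x).source)
    (i : Fin (k + 1)) (A : Fin n) (V : JetCoord n k) : dq x i A p (coordVec x p V) = V i A := by
  have hd : DifferentiableAt ℝ (fun q : JetCoord n k => q i A) (natCoord x p) := by fun_prop
  have hm : MDifferentiableAt 𝓘(ℝ, JetCoord n k) 𝓘(ℝ, ℝ)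
      (fun p' : HOTangent n k Q => natCoord x p' i A) p :=
    MDifferentiableAt.comp (g := fun q : JetCoord n k => q i A) p hd.mdifferentiableAt
      (mdifferentiableAt_natCoord hx)
  unfold dq
  rw [dFun_coordVec hx hm]
  have h : (fun q : JetCoord n k => natCoord x ((jetChart x).symm q : HOTangent n k Q) i A)
      =ᶠ[𝓝 (natCoord x p)] fun q => q i A := by
    filter_upwards [(isOpen_target x).mem_nhds (natCoord_mem_target hx)] with q hq
    rw [natCoord_jetChart_symm hq]
  rw [h.fderiv_eq]
  have h2 : HasFDerivAt (fun q : JetCoord n k => q i A)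
      ((EuclideanSpace.proj A : Coord n →L[ℝ] ℝ).comp (ContinuousLinearMap.proj i)) (natCoord x p) :=
    ((EuclideanSpace.proj A : Coord n →L[ℝ] ℝ).comp
      (ContinuousLinearMap.proj (R := ℝ) (φ := fun _ : Fin (k + 1) => Coord n) i)).hasFDerivAt
  rw [h2.fderiv]
  rfl

theorem sum_partialQ (x : Q) (p : HOTangent n k Q) (V : JetCoord n k) :
    coordVec x p V = ∑ i : Fin (k + 1), ∑ A : Fin n, V i A • partialQ x i A p := by
  have hV : V = ∑ i : Fin (k + 1), ∑ A : Fin n,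
      V i A • (Pi.single i (EuclideanSpace.single A (1 : ℝ)) : JetCoord n k) := by
    funext j
    ext B
    simp [Finset.sum_apply, Pi.single_apply, apply_ite]
  conv_lhs => rw [hV]
  simp only [map_sum, map_smul]
  rfl

end Charts

/-! ### Tangent vectors as jets of vector fields along curves -/

section Jets

variable {n k : ℕ} {Q : Type*} [TopologicalSpace Q] [ChartedSpace (Coord n) Q]
  [IsManifold (𝓡 n) ∞ Q]

/-- The tangent vector to `T^m Q` at the `m`-jet of `σ` at time `t` obtained by prolonging the
vector field along `σ` with components `v` in the chart of `Q` at `x`. -/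
def jetVec (m : ℕ) (x : Q) (σ : Curve n Q) (v : ℝ → Coord n) (t : ℝ) : TSp (lift m σ t) :=
  coordVec x (lift m σ t) fun i => iteratedDeriv i v t

/-- The components in the chart at `y` of a vector field along `σ` with components `v` in the
chart at `x`. -/
def changeVec (x y : Q) (σ : Curve n Q) (v : ℝ → Coord n) (s : ℝ) : Coord n :=
  fderiv ℝ (trans x y) (chartAt (Coord n) x (σ s)) (v s)

theorem jetVec_congr {m : ℕ} {x : Q} {σ : Curve n Q} {v w : ℝ → Coord n} {t : ℝ}
    (h : v =ᶠ[𝓝 t] w) : jetVec m x σ v t = jetVec m x σ w t := by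
  unfold jetVec
  congr 1
  funext i
  exact h.iteratedDeriv_eq i

theorem contDiffAt_changeVec {x y : Q} {σ : Curve n Q} {v : ℝ → Coord n} {t : ℝ}
    (hx : σ t ∈ (chartAt (Coord n) x).source) (hy : σ t ∈ (chartAt (Coord n) y).source)
    (hv : ContDiffAt ℝ ∞ v t) : ContDiffAt ℝ ∞ (changeVec x y σ v) t := by
  have h1 : ContDiffAt ℝ ∞ (fderiv ℝ (trans x y)) (chartAt (Coord n) x (σ t)) :=
    (contDiffAt_trans ((chartAt (Coord n) x).map_source hx)
      (by rwa [(chartAt (Coord n) x).left_inv hx])).fderiv_right (m := ∞) le_rfl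
  exact (h1.comp t (contDiffAt_chart_comp hx)).clm_apply hv

/-- By `fderiv_transJet`, prolongation commutes with the change of charts, so `jetVec` depends only
on the vector field along `σ`. All later chart independence rests on this. -/
theorem jetVec_trans {m : ℕ} {x y : Q} {σ : Curve n Q} {v : ℝ → Coord n} {t : ℝ}
    (hx : σ t ∈ (chartAt (Coord n) x).source) (hy : σ t ∈ (chartAt (Coord n) y).source)
    (hv : ContDiffAt ℝ ∞ v t) : jetVec m x σ v t = jetVec m y σ (changeVec x y σ v) t := by
  have hx' : (lift m σ t).base ∈ (chartAt (Coord n) x).source := by rwa [base_lift]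
  have hy' : (lift m σ t).base ∈ (chartAt (Coord n) y).source := by rwa [base_lift]
  have hd := differentiableAt_transJet (k := m) hx' hy'
  unfold jetVec
  rw [coordVec_trans hx' hy']
  rw [natCoord_lift hx] at hd ⊢
  congr 1
  exact fderiv_transJet (contDiffAt_chart_comp hx) hv ((chartAt (Coord n) x).map_source hx)
      (by rwa [(chartAt (Coord n) x).left_inv hx]) hd

theorem coordVec_of_eq {x : Q} {p : HOTangent n k Q} (h : x = p.base) (V : JetCoord n k) :
    coordVec x p V = V := by
  subst h
  exact coordVec_base p V

theorem iteratedDeriv_deriv {v : ℝ → Coord n} {t : ℝ} (i : ℕ) :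
    iteratedDeriv i (deriv v) t = iteratedDeriv (i + 1) v t := by
  rw [iteratedDeriv_succ']

/-- The canonical injection in terms of prolongations. -/
theorem canInj_lift {r : ℕ} (h : r + 1 ≤ k) {x : Q} {σ : Curve n Q} {t : ℝ}
    (hx : σ t ∈ (chartAt (Coord n) x).source) :
    canInj h (lift k σ t) = jetVec r x σ (deriv fun s => chartAt (Coord n) x (σ s)) t := by
  let b : Q := (lift k σ t).base
  have hb : σ t ∈ (chartAt (Coord n) b).source := by
    rw [show b = σ t from base_lift σ t]
    exact mem_chart_source _ _
  have hd : ContDiffAt ℝ ∞ (deriv fun s => chartAt (Coord n) x (σ s)) t :=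
    (contDiffAt_chart_comp hx).derivWithin (m := ∞) le_rfl
  rw [jetVec_trans hx hb hd]
  -- By the chain rule the velocity of `σ` transforms as a vector field along `σ`; this moves the
  -- claim to the preferred chart, where `liftVelocity_eq` computes the lift.
  have hc : changeVec x b σ (deriv fun s => chartAt (Coord n) x (σ s)) =ᶠ[𝓝 t]
      deriv fun s => chartAt (Coord n) b (σ s) := by
    filter_upwards [eventually_mem_source hx, eventually_mem_source hb] with s hs hs'
    have h1 : HasDerivAt (fun s => chartAt (Coord n) x (σ s))
        (deriv (fun s => chartAt (Coord n) x (σ s)) s) s :=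
      ((contDiffAt_chart_comp hs).differentiableAt (by simp)).hasDerivAt
    have h2 : DifferentiableAt ℝ (trans x b) (chartAt (Coord n) x (σ s)) :=
      (contDiffAt_trans ((chartAt (Coord n) x).map_source hs)
        (by rwa [(chartAt (Coord n) x).left_inv hs])).differentiableAt (by simp)
    have h3 : (fun s => chartAt (Coord n) b (σ s)) =ᶠ[𝓝 s]
        fun s => trans x b (chartAt (Coord n) x (σ s)) := by
      filter_upwards [eventually_mem_source hs] with u hu
      simp [trans, (chartAt (Coord n) x).left_inv hu]
    rw [h3.deriv_eq]
    exact (h2.hasFDerivAt.comp_hasDerivAt s h1).deriv.symm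
  rw [jetVec_congr hc]
  have h1 : canInj h (lift k σ t) = liftVelocity r (shift σ t) := rfl
  rw [h1, liftVelocity_eq]
  unfold jetVec
  refine Eq.trans ?_ (coordVec_of_eq (p := lift r σ t) (x := b) rfl _).symm
  funext i
  rw [derivIn_shift, iteratedDeriv_deriv]
  rfl

theorem projT_jetVec {r m : ℕ} (h : r ≤ m) {x : Q} {σ : Curve n Q} {v : ℝ → Coord n} {t : ℝ}
    (hx : σ t ∈ (chartAt (Coord n) x).source) :
    projT h (lift m σ t) (jetVec m x σ v t) = jetVec r x σ v t := by
  unfold jetVec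
  rw [projT_coordVec h (by rwa [base_lift])]
  rfl

/-- Every tuple of vectors is the tuple of derivatives of a smooth function. -/
theorem exists_jet (V : JetCoord n k) (t : ℝ) : ∃ v : ℝ → Coord n, ContDiff ℝ ∞ v ∧
    (fun i : Fin (k + 1) => iteratedDeriv i v t) = V := by
  refine ⟨fun s => ∑ j : Fin (k + 1), (s - t) ^ (j : ℕ) • (((j : ℕ).factorial : ℝ)⁻¹ • V j),
    by fun_prop, ?_⟩
  funext i
  rw [iteratedDeriv_fun_sum fun j _ => by fun_prop, Finset.sum_eq_single i]
  · rw [iteratedDeriv_sub_pow_smul contDiffAt_const, if_pos le_rfl, Nat.sub_self, iteratedDeriv_zero,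
      smul_smul]
    simp [Nat.factorial_ne_zero]
  · intro j _ hj
    rw [iteratedDeriv_sub_pow_smul contDiffAt_const]
    split_ifs with h
    · have : (i : ℕ) - j ≠ 0 := fun h' => hj (Fin.ext (by omega))
      rw [iteratedDeriv_const, if_neg this, smul_zero]
    · rfl
  · simp

end Jets

/-! ### Tulczyjew's derivation on functions -/

section Functions

variable {n k : ℕ} {Q : Type*} [TopologicalSpace Q] [ChartedSpace (Coord n) Q]
  [IsManifold (𝓡 n) ∞ Q]

/-- Tulczyjew's derivation on functions in natural coordinates. -/
theorem dT_eq {f : HOTangent n k Q → ℝ} {x : Q} {p : HOTangent n (k + 1) Q}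
    (hx : p.base ∈ (chartAt (Coord n) x).source)
    (hf : MDifferentiableAt 𝓘(ℝ, JetCoord n k) 𝓘(ℝ, ℝ) f (proj k.le_succ p)) :
    dT f p = fderiv ℝ (fun q => f ((jetChart x).symm q)) (truncate n k.le_succ (natCoord x p))
      (fun i : Fin (k + 1) => natCoord x p i.succ) := by
  obtain ⟨σ, rfl⟩ := jet_surj p
  have hx' : σ 0 ∈ (chartAt (Coord n) x).source := hx
  rw [← natCoord_proj k.le_succ hx]
  rw [← lift_zero] at hf hx ⊢
  unfold dT
  rw [canInj_lift le_rfl hx']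
  unfold jetVec
  rw [proj_lift] at hf
  refine (dFun_coordVec (x := x) (by exact hx) hf _).trans ?_
  rw [proj_lift]
  congr 1
  funext i
  rw [natCoord_lift hx', iteratedDeriv_deriv]
  rfl

/-- Along a lift, the coordinate `q_i` has time derivative `q_{i+1}`, so the chain rule reproduces
the coordinate formula of `dT_eq`. Thus `d_T` is the time derivative along lifted curves. -/
theorem hasDerivAt_comp_lift {f : HOTangent n k Q → ℝ} {σ : Curve n Q} {t : ℝ}
    (hf : MDifferentiableAt 𝓘(ℝ, JetCoord n k) 𝓘(ℝ, ℝ) f (lift k σ t)) :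
    HasDerivAt (fun s => f (lift k σ s)) (dT f (lift (k + 1) σ t)) t := by
  let x := σ t
  have hx : σ t ∈ (chartAt (Coord n) x).source := mem_chart_source _ _
  have hx' : (lift k σ t).base ∈ (chartAt (Coord n) x).source := by rwa [base_lift]
  rw [dT_eq (x := x) (by rwa [base_lift]) hf, ← natCoord_proj k.le_succ (by rwa [base_lift])]
  have h1 := hasFDerivAt_comp_jetChart_symm hx' hf.hasMFDerivAt
  have h2 : DifferentiableAt ℝ (fun q => f ((jetChart x).symm q)) (natCoord x (lift k σ t)) :=
    h1.differentiableAt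
  have h3 := hasDerivAt_jet (contDiffAt_chart_comp hx) k
  have h4 : natCoord x (lift k σ t) = fun i : Fin (k + 1) => derivIn x σ t i := natCoord_lift hx
  have h5 : (fun s => f (lift k σ s)) =ᶠ[𝓝 t] fun s =>
      f ((jetChart x).symm fun i : Fin (k + 1) => derivIn x σ s i) := by
    filter_upwards [eventually_mem_source hx] with s hs
    rw [← natCoord_lift hs, jetChart_symm_natCoord (by rwa [base_lift])]
  refine HasDerivAt.congr_of_eventuallyEq ?_ h5
  rw [proj_lift, natCoord_lift hx, natCoord_lift hx]
  rw [h4] at h2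
  exact h2.hasFDerivAt.comp_hasDerivAt t h3

theorem contDiffOn_comp_jetChart_symm {F : Type*} [NormedAddCommGroup F] [NormedSpace ℝ F]
    {f : HOTangent n k Q → F} {x : Q}
    (hf : ContMDiffOn 𝓘(ℝ, JetCoord n k) 𝓘(ℝ, F) ∞ f
      {p | p.base ∈ (chartAt (Coord n) x).source}) :
    ContDiffOn ℝ ∞ (fun q : JetCoord n k => f ((jetChart x).symm q))
      {q : JetCoord n k | q 0 ∈ (chartAt (Coord n) x).target} :=
  (hf.comp (contMDiffOn_jetChart_symm x) fun _ hq => base_jetChart_symm hq).contDiffOn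

theorem contMDiffOn_comp_natCoord {F : Type*} [NormedAddCommGroup F] [NormedSpace ℝ F]
    {g : JetCoord n k → F} {x : Q}
    (hg : ContDiffOn ℝ ∞ g {q : JetCoord n k | q 0 ∈ (chartAt (Coord n) x).target}) :
    ContMDiffOn 𝓘(ℝ, JetCoord n k) 𝓘(ℝ, F) ∞ (fun p : HOTangent n k Q => g (natCoord x p))
      {p | p.base ∈ (chartAt (Coord n) x).source} :=
  hg.contMDiffOn.comp (contMDiffOn_natCoord x) fun _ hp => natCoord_mem_target hp

theorem contMDiffOn_dT {f : HOTangent n k Q → ℝ} {x : Q}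
    (hf : ContMDiffOn 𝓘(ℝ, JetCoord n k) 𝓘(ℝ, ℝ) ∞ f
      {p | p.base ∈ (chartAt (Coord n) x).source}) :
    ContMDiffOn 𝓘(ℝ, JetCoord n (k + 1)) 𝓘(ℝ, ℝ) ∞ (dT f)
      {p | p.base ∈ (chartAt (Coord n) x).source} := by
  have h1 := (contDiffOn_comp_jetChart_symm hf).fderiv_of_isOpen (m := ∞) (isOpen_target x) le_rfl
  have h2 : ContDiffOn ℝ ∞ (fun q : JetCoord n (k + 1) =>
      fderiv ℝ (fun q => f ((jetChart x).symm q)) (truncate n k.le_succ q)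
        (fun i : Fin (k + 1) => q i.succ)) {q | q 0 ∈ (chartAt (Coord n) x).target} := by
    refine ContDiffOn.clm_apply (h1.comp (truncate n k.le_succ).contDiff.contDiffOn ?_)
      (by fun_prop)
    intro q hq
    exact hq
  refine (contMDiffOn_comp_natCoord h2).congr fun p hp => ?_
  exact dT_eq hp ((hf.contMDiffAt ((isOpen_base_source x).mem_nhds
    (by simpa [base_proj] using hp))).mdifferentiableAt (by simp))

theorem contMDiff_of_forall_chart {f : HOTangent n k Q → ℝ}
    (hf : ∀ x : Q, ContMDiffOn 𝓘(ℝ, JetCoord n k) 𝓘(ℝ, ℝ) ∞ f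
      {p | p.base ∈ (chartAt (Coord n) x).source}) :
    ContMDiff 𝓘(ℝ, JetCoord n k) 𝓘(ℝ, ℝ) ∞ f := fun p =>
  (hf p.base).contMDiffAt ((isOpen_base_source _).mem_nhds (mem_chart_source _ _))

theorem contMDiff_dT {f : HOTangent n k Q → ℝ} (hf : ContMDiff 𝓘(ℝ, JetCoord n k) 𝓘(ℝ, ℝ) ∞ f) :
    ContMDiff 𝓘(ℝ, JetCoord n (k + 1)) 𝓘(ℝ, ℝ) ∞ (dT f) :=
  contMDiff_of_forall_chart fun _ => contMDiffOn_dT hf.contMDiffOn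

theorem contMDiff_dTIter {f : HOTangent n k Q → ℝ}
    (hf : ContMDiff 𝓘(ℝ, JetCoord n k) 𝓘(ℝ, ℝ) ∞ f) (s : ℕ) :
    ContMDiff 𝓘(ℝ, JetCoord n (k + s)) 𝓘(ℝ, ℝ) ∞ (dTIter f s) := by
  induction s with
  | zero => exact hf
  | succ s ih => exact contMDiff_dT ih

theorem dT_eq_zero {f : HOTangent n k Q → ℝ} {p : HOTangent n (k + 1) Q}
    (hf : ∀ᶠ p' in 𝓝 (proj k.le_succ p), f p' = 0) : dT f p = 0 := by
  have h : HasMFDerivAt 𝓘(ℝ, JetCoord n k) 𝓘(ℝ, ℝ) f (proj k.le_succ p)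
      (0 : JetCoord n k →L[ℝ] ℝ) :=
    (hasMFDerivAt_const (0 : ℝ) _).congr_of_eventuallyEq hf
  unfold dT dFun
  rw [h.mfderiv]
  rfl

end Functions

/-! ### Tulczyjew's derivation on 1-forms, smoothness and semibasic order -/

section Forms

variable {n k : ℕ} {Q : Type*} [TopologicalSpace Q] [ChartedSpace (Coord n) Q]
  [IsManifold (𝓡 n) ∞ Q]

/-- Smoothness of a `1`-form: its components in all natural charts are smooth. -/
def SmoothForm (θ : OneForm n k Q) : Prop :=
  ∀ (x : Q) (i : Fin (k + 1)) (A : Fin n),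
    ContMDiffOn 𝓘(ℝ, JetCoord n k) 𝓘(ℝ, ℝ) ∞ (fun p => θ p (partialQ x i A p))
      {p | p.base ∈ (chartAt (Coord n) x).source}

/-- A `1`-form is semibasic over `T^j Q` if its components along `dq_i^A` vanish for `j < i`. -/
def IsSemibasic (j : ℕ) (θ : OneForm n k Q) : Prop :=
  ∀ (x : Q) (p : HOTangent n k Q), p.base ∈ (chartAt (Coord n) x).source →
    ∀ i : Fin (k + 1), j < (i : ℕ) → ∀ A : Fin n, θ p (partialQ x i A p) = 0

/-- The right-hand side of the coordinate expression of `d_T θ` over the chart of `Q` at `x`. -/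
def dTFormIn (x : Q) (θ : OneForm n k Q) : OneForm n (k + 1) Q := fun p =>
  ∑ i : Fin (k + 1), ∑ A : Fin n,
    (dT (fun p' => θ p' (partialQ x i A p')) p • dq x i.castSucc A p +
      θ (proj k.le_succ p) (partialQ x i A (proj k.le_succ p)) • dq x i.succ A p)

theorem dTFormIn_coordVec (x : Q) (θ : OneForm n k Q) {p : HOTangent n (k + 1) Q}
    (hx : p.base ∈ (chartAt (Coord n) x).source) (V : JetCoord n (k + 1)) :
    dTFormIn x θ p (coordVec x p V) = ∑ i : Fin (k + 1), ∑ A : Fin n,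
      (dT (fun p' => θ p' (partialQ x i A p')) p * V i.castSucc A +
        θ (proj k.le_succ p) (partialQ x i A (proj k.le_succ p)) * V i.succ A) := by
  simp only [dTFormIn, sum_apply, add_apply,
    smul_apply, dq_coordVec hx, smul_eq_mul]

/-- The product rule: the coefficient `a_i^A` contributes `d_T a_i^A`, and the `i`-th derivative of
`v` contributes the next one, which is where `dq_{i+1}^A` comes from. -/
theorem hasDerivAt_dTFormIn {θ : OneForm n k Q} (hθ : SmoothForm θ) {x : Q} {σ : Curve n Q}
    {v : ℝ → Coord n} {t : ℝ} (hx : σ t ∈ (chartAt (Coord n) x).source)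
    (hv : ContDiffAt ℝ ∞ v t) :
    HasDerivAt (fun s => θ (lift k σ s) (jetVec k x σ v s))
      (dTFormIn x θ (lift (k + 1) σ t) (jetVec (k + 1) x σ v t)) t := by
  have hfun : (fun s => θ (lift k σ s) (jetVec k x σ v s)) = fun s =>
      ∑ i : Fin (k + 1), ∑ A : Fin n, θ (lift k σ s) (partialQ x i A (lift k σ s)) *
        iteratedDeriv i v s A := by
    funext s
    unfold jetVec
    rw [sum_partialQ]
    simp only [map_sum, map_smul, smul_eq_mul, mul_comm]
  rw [hfun, jetVec, dTFormIn_coordVec x θ (by rwa [base_lift])]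
  refine HasDerivAt.fun_sum fun i _ => HasDerivAt.fun_sum fun A _ => ?_
  have h1 : HasDerivAt (fun s => iteratedDeriv i v s A) (iteratedDeriv (i + 1) v t A) t :=
    (EuclideanSpace.proj A : Coord n →L[ℝ] ℝ).hasFDerivAt.comp_hasDerivAt t
      (hasDerivAt_iteratedDeriv hv i)
  have h2 : MDifferentiableAt 𝓘(ℝ, JetCoord n k) 𝓘(ℝ, ℝ) (fun p => θ p (partialQ x i A p))
      (lift k σ t) :=
    ((hθ x i A).contMDiffAt ((isOpen_base_source x).mem_nhds
      (by simpa [base_lift] using hx))).mdifferentiableAt (by simp)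
  exact (hasDerivAt_comp_lift h2).mul h1

theorem hasDerivAt_dTForm {θ : OneForm n k Q} (hθ : SmoothForm θ) {x : Q} {σ : Curve n Q}
    {v : ℝ → Coord n} {t : ℝ} (hx : σ t ∈ (chartAt (Coord n) x).source)
    (hv : ContDiffAt ℝ ∞ v t) (hv' : ∀ᶠ s in 𝓝 t, ContDiffAt ℝ ∞ v s) :
    HasDerivAt (fun s => θ (lift k σ s) (jetVec k x σ v s))
      (dTForm θ (lift (k + 1) σ t) (jetVec (k + 1) x σ v t)) t := by
  let b : Q := (lift (k + 1) σ t).base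
  have hb : σ t ∈ (chartAt (Coord n) b).source := by
    rw [show b = σ t from base_lift σ t]
    exact mem_chart_source _ _
  -- At this point `dTForm` is `dTFormIn` for the chart `b`. The function being differentiated must
  -- be rewritten in that chart at all nearby times, hence smoothness of `v` near `t`.
  rw [jetVec_trans hx hb hv]
  refine (hasDerivAt_dTFormIn hθ hb (contDiffAt_changeVec hx hb hv)).congr_of_eventuallyEq ?_
  filter_upwards [eventually_mem_source hx, eventually_mem_source hb, hv'] with s hs hs' hvs
  rw [jetVec_trans hs hs' hvs]

/-- The coordinate expression of `d_T θ` is valid in every natural chart. -/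
theorem dTForm_eq {θ : OneForm n k Q} (hθ : SmoothForm θ) {x : Q} {p : HOTangent n (k + 1) Q}
    (hx : p.base ∈ (chartAt (Coord n) x).source) (V : JetCoord n (k + 1)) :
    dTForm θ p (coordVec x p V) = ∑ i : Fin (k + 1), ∑ A : Fin n,
      (dT (fun p' => θ p' (partialQ x i A p')) p * V i.castSucc A +
        θ (proj k.le_succ p) (partialQ x i A (proj k.le_succ p)) * V i.succ A) := by
  rw [← dTFormIn_coordVec x θ hx]
  obtain ⟨σ, rfl⟩ := jet_surj p
  obtain ⟨v, hv, rfl⟩ := exists_jet V 0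
  have hx' : σ 0 ∈ (chartAt (Coord n) x).source := hx
  rw [← lift_zero]
  -- Both sides are derivatives of the same function of time, and every point and vector arises from
  -- some `σ` and `v`.
  exact (hasDerivAt_dTForm hθ hx' hv.contDiffAt
    (Filter.Eventually.of_forall fun _ => hv.contDiffAt)).unique
      (hasDerivAt_dTFormIn hθ hx' hv.contDiffAt)

/-- The definition of `dTForm` uses a chart that varies with the point; `dTForm_eq` fixes one chart,
in which the components are visibly smooth. -/
theorem SmoothForm.dTForm {θ : OneForm n k Q} (hθ : SmoothForm θ) : SmoothForm (dTForm θ) := by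
  intro x j B
  have h1 : ∀ i : Fin (k + 1), ∀ A : Fin n, ContMDiffOn 𝓘(ℝ, JetCoord n (k + 1)) 𝓘(ℝ, ℝ) ∞
      (fun p : HOTangent n (k + 1) Q =>
        θ (proj k.le_succ p) (partialQ x i A (proj k.le_succ p)))
      {p | p.base ∈ (chartAt (Coord n) x).source} := fun i A =>
    (hθ x i A).comp (contMDiff_proj k.le_succ).contMDiffOn fun p hp => by
      simpa [base_proj] using hp
  have h2 : ContMDiffOn 𝓘(ℝ, JetCoord n (k + 1)) 𝓘(ℝ, ℝ) ∞
      (fun p : HOTangent n (k + 1) Q => ∑ i : Fin (k + 1), ∑ A : Fin n,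
      (dT (fun p' => θ p' (partialQ x i A p')) p *
          (Pi.single j (EuclideanSpace.single B (1 : ℝ)) : JetCoord n (k + 1)) i.castSucc A +
        θ (proj k.le_succ p) (partialQ x i A (proj k.le_succ p)) *
          (Pi.single j (EuclideanSpace.single B (1 : ℝ)) : JetCoord n (k + 1)) i.succ A))
      {p | p.base ∈ (chartAt (Coord n) x).source} := by
    refine contMDiffOn_finsetSum fun i _ => contMDiffOn_finsetSum fun A _ => ?_
    exact ((contMDiffOn_dT (hθ x i A)).mul contMDiffOn_const).add ((h1 i A).mul contMDiffOn_const)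
  exact h2.congr fun p hp => dTForm_eq hθ hp _

/-- The component of `d_T θ` along `dq_l` involves only `d_T a_l` and `a_{l-1}`; for `l > j + 1`
both `a_l` and `a_{l-1}` vanish identically over the chart. -/
theorem IsSemibasic.dTForm {θ : OneForm n k Q} {j : ℕ} (hθ : SmoothForm θ)
    (hj : IsSemibasic j θ) : IsSemibasic (j + 1) (dTForm θ) := by
  intro x p hx l hl B
  rw [partialQ_eq, dTForm_eq hθ hx]
  have hpx : (proj k.le_succ p).base ∈ (chartAt (Coord n) x).source := by rwa [base_proj]
  refine Finset.sum_eq_zero fun i _ => Finset.sum_eq_zero fun A _ => ?_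
  by_cases hi : j < (i : ℕ)
  · rw [hj x _ hpx i hi, dT_eq_zero, zero_mul, zero_mul, add_zero]
    filter_upwards [(isOpen_base_source x).mem_nhds hpx] with p' hp'
    exact hj x p' hp' i hi A
  · rw [Pi.single_eq_of_ne, Pi.single_eq_of_ne]
    · simp
    · rintro rfl
      simp at hl
      omega
    · rintro rfl
      simp at hl
      omega

theorem SmoothForm.dTFormIter {θ : OneForm n k Q} (hθ : SmoothForm θ) (s : ℕ) :
    SmoothForm (dTFormIter θ s) := by
  induction s with
  | zero => exact hθ
  | succ s ih => exact ih.dTForm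

theorem IsSemibasic.dTFormIter {θ : OneForm n k Q} {j : ℕ} (hθ : SmoothForm θ)
    (hj : IsSemibasic j θ) (s : ℕ) : IsSemibasic (j + s) (dTFormIter θ s) := by
  induction s with
  | zero => exact hj
  | succ s ih => exact IsSemibasic.dTForm (hθ.dTFormIter s) ih

/-- Contraction with the velocity of the lifted curves commutes with `d_T`. -/
theorem dTFormIter_velocity {θ : OneForm n k Q} {f : HOTangent n k Q → ℝ} (hθ : SmoothForm θ)
    (hf : ContMDiff 𝓘(ℝ, JetCoord n k) 𝓘(ℝ, ℝ) ∞ f) {x : Q} {σ : Curve n Q}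
    (h : ∀ t, σ t ∈ (chartAt (Coord n) x).source →
      θ (lift k σ t) (jetVec k x σ (deriv fun s => chartAt (Coord n) x (σ s)) t) =
        f (lift k σ t)) (s : ℕ) {t : ℝ} (ht : σ t ∈ (chartAt (Coord n) x).source) :
    dTFormIter θ s (lift (k + s) σ t)
      (jetVec (k + s) x σ (deriv fun s => chartAt (Coord n) x (σ s)) t) =
        dTIter f s (lift (k + s) σ t) := by
  -- The identity is needed at all times near `t`, since the inductive step differentiates it along
  -- the curve.
  induction s generalizing t with
  | zero => exact h t ht
  | succ s ih =>
    have hd : ∀ u, σ u ∈ (chartAt (Coord n) x).source →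
        ContDiffAt ℝ ∞ (deriv fun s => chartAt (Coord n) x (σ s)) u := fun u hu =>
      (contDiffAt_chart_comp hu).derivWithin (m := ∞) le_rfl
    have h1 := hasDerivAt_dTForm (hθ.dTFormIter s) ht (hd t ht)
      ((eventually_mem_source ht).mono hd)
    have h2 := hasDerivAt_comp_lift (σ := σ) (t := t)
      ((contMDiff_dTIter hf s _).mdifferentiableAt (by simp))
    refine h1.unique (h2.congr_of_eventuallyEq ?_)
    filter_upwards [eventually_mem_source ht] with u hu using ih hu

end Forms

/-! ### Vertical endomorphisms and canonical vector fields -/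

section Vertical

variable {n k : ℕ} {Q : Type*} [TopologicalSpace Q] [ChartedSpace (Coord n) Q]
  [IsManifold (𝓡 n) ∞ Q]

/-- The coordinate expression of the vertical endomorphism `J_r`. -/
def shiftUp (n k r : ℕ) : JetCoord n k →L[ℝ] JetCoord n k :=
  ContinuousLinearMap.pi fun i => if r ≤ (i : ℕ) then
    (((i : ℕ).factorial : ℝ) / (((i : ℕ) - r).factorial : ℝ)) •
      ContinuousLinearMap.proj (⟨(i : ℕ) - r, by omega⟩ : Fin (k + 1))
    else 0

theorem shiftUp_apply (r : ℕ) (V : JetCoord n k) (i : Fin (k + 1)) :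
    shiftUp n k r V i = if r ≤ (i : ℕ) then
      (((i : ℕ).factorial : ℝ) / (((i : ℕ) - r).factorial : ℝ)) •
        V ⟨(i : ℕ) - r, by omega⟩ else 0 := by
  unfold shiftUp
  rw [ContinuousLinearMap.pi_apply]
  split_ifs <;> rfl

theorem connecting_apply {r : ℕ} (h : r ≤ k) (p : HOTangent n k Q) (W : JetCoord n (k - r))
    (i : Fin (k + 1)) : (show JetCoord n k from connecting h p W) i = if hi : r ≤ (i : ℕ) then
      (((i : ℕ).factorial : ℝ) / (((i : ℕ) - r).factorial : ℝ)) • W ⟨(i : ℕ) - r, by omega⟩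
    else 0 := by
  let T : JetCoord n (k - r) →L[ℝ] JetCoord n k :=
    ContinuousLinearMap.pi fun i => if hi : r ≤ (i : ℕ) then
      (((i : ℕ).factorial : ℝ) / (((i : ℕ) - r).factorial : ℝ)) •
        ContinuousLinearMap.proj (⟨(i : ℕ) - r, by omega⟩ : Fin (k - r + 1))
      else 0
  have hT : T W i = if hi : r ≤ (i : ℕ) then
      (((i : ℕ).factorial : ℝ) / (((i : ℕ) - r).factorial : ℝ)) • W ⟨(i : ℕ) - r, by omega⟩
      else 0 := by
    simp only [T, ContinuousLinearMap.pi_apply]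
    split_ifs <;> rfl
  exact hT

/-- Multiplying `v` by `(s - t)^r` commutes with the fibrewise linear change of charts, so the claim
need only be checked in the preferred chart, where the factors of `connecting` are those of
`iteratedDeriv_sub_pow_smul`. -/
theorem vertEndo_jetVec {r : ℕ} (h : r ≤ k) {x : Q} {σ : Curve n Q} {v : ℝ → Coord n} {t : ℝ}
    (hx : σ t ∈ (chartAt (Coord n) x).source) (hv : ContDiffAt ℝ ∞ v t) :
    vertEndo h (lift k σ t) (jetVec k x σ v t) =
      jetVec k x σ (fun s => (s - t) ^ r • v s) t := by
  let b : Q := (lift k σ t).base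
  have hb : σ t ∈ (chartAt (Coord n) b).source := by
    rw [show b = σ t from base_lift σ t]
    exact mem_chart_source _ _
  have hw := contDiffAt_changeVec hx hb hv
  have hc : changeVec x b σ (fun s => (s - t) ^ r • v s) =
      fun s => (s - t) ^ r • changeVec x b σ v s := by
    funext s
    simp only [changeVec, map_smul]
  have hv' : ContDiffAt ℝ ∞ (fun s => (s - t) ^ r • v s) t :=
    ContDiffAt.smul (f := fun s : ℝ => (s - t) ^ r) (by fun_prop) hv
  rw [jetVec_trans hx hb hv, jetVec_trans hx hb hv', hc]
  unfold vertEndo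
  rw [ContinuousLinearMap.comp_apply, projT_jetVec _ hb]
  have h1 : jetVec (k - r) b σ (changeVec x b σ v) t =
      (fun i : Fin (k - r + 1) => iteratedDeriv i (changeVec x b σ v) t : JetCoord n (k - r)) :=
    coordVec_of_eq (p := lift (k - r) σ t) (x := b) rfl _
  have h2 : jetVec k b σ (fun s => (s - t) ^ r • changeVec x b σ v s) t =
      (fun i : Fin (k + 1) => iteratedDeriv i (fun s => (s - t) ^ r • changeVec x b σ v s) t :
        JetCoord n k) :=
    coordVec_of_eq (p := lift k σ t) (x := b) rfl _
  rw [h1, h2]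
  funext i
  rw [iteratedDeriv_sub_pow_smul hw]
  exact connecting_apply h _ _ i

theorem vertEndo_coordVec {r : ℕ} (h : r ≤ k) {x : Q} {p : HOTangent n k Q}
    (hx : p.base ∈ (chartAt (Coord n) x).source) (V : JetCoord n k) :
    vertEndo h p (coordVec x p V) = coordVec x p (shiftUp n k r V) := by
  obtain ⟨σ, rfl⟩ := jet_surj p
  obtain ⟨v, hv, rfl⟩ := exists_jet V 0
  rw [← lift_zero]
  refine (vertEndo_jetVec h hx hv.contDiffAt).trans ?_
  unfold jetVec
  congr 1
  funext i
  rw [iteratedDeriv_sub_pow_smul hv.contDiffAt, shiftUp_apply]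

theorem vertDiff_coordVec {r : ℕ} (h : r ≤ k) {L : HOTangent n k Q → ℝ}
    (hL : ContMDiff 𝓘(ℝ, JetCoord n k) 𝓘(ℝ, ℝ) ∞ L) {x : Q} {p : HOTangent n k Q}
    (hx : p.base ∈ (chartAt (Coord n) x).source) (V : JetCoord n k) :
    vertDiff h L p (coordVec x p V) =
      fderiv ℝ (fun q => L ((jetChart x).symm q)) (natCoord x p) (shiftUp n k r V) := by
  unfold vertDiff
  rw [ContinuousLinearMap.comp_apply, vertEndo_coordVec h hx,
    dFun_coordVec hx ((hL p).mdifferentiableAt (by simp))]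

/-- The components `V` may vary with the point: constant `V` gives smoothness of `d_{J_r}L`, and `V
= shiftDown n k` gives smoothness of `Δ_r(L)`. -/
theorem contMDiffOn_vertDiff_coordVec {r : ℕ} (h : r ≤ k) {L : HOTangent n k Q → ℝ}
    (hL : ContMDiff 𝓘(ℝ, JetCoord n k) 𝓘(ℝ, ℝ) ∞ L) (x : Q) {V : JetCoord n k → JetCoord n k}
    (hV : ContDiff ℝ ∞ V) :
    ContMDiffOn 𝓘(ℝ, JetCoord n k) 𝓘(ℝ, ℝ) ∞
      (fun p => vertDiff h L p (coordVec x p (V (natCoord x p))))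
      {p | p.base ∈ (chartAt (Coord n) x).source} := by
  have h1 := (contDiffOn_comp_jetChart_symm (x := x) hL.contMDiffOn).fderiv_of_isOpen (m := ∞)
    (isOpen_target x) le_rfl
  have h2 := contMDiffOn_comp_natCoord (Q := Q) (h1.clm_apply
    ((shiftUp n k r).contDiff.comp hV).contDiffOn)
  exact h2.congr fun p hp => vertDiff_coordVec h hL hp _

theorem smoothForm_vertDiff {r : ℕ} (h : r ≤ k) {L : HOTangent n k Q → ℝ}
    (hL : ContMDiff 𝓘(ℝ, JetCoord n k) 𝓘(ℝ, ℝ) ∞ L) : SmoothForm (vertDiff h L) := fun x _ _ =>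
  contMDiffOn_vertDiff_coordVec h hL x contDiff_const

/-- `J_r` raises the index by `r`, so it kills `∂/∂q_i` as soon as `i + r > k`. -/
theorem isSemibasic_vertDiff {r : ℕ} (h : r ≤ k) {L : HOTangent n k Q → ℝ}
    (hL : ContMDiff 𝓘(ℝ, JetCoord n k) 𝓘(ℝ, ℝ) ∞ L) : IsSemibasic (k - r) (vertDiff h L) := by
  intro x p hx i hi A
  rw [partialQ_eq, vertDiff_coordVec h hL hx]
  refine (congrArg _ ?_).trans (map_zero _)
  funext j
  rw [shiftUp_apply]
  split_ifs with hj
  · rw [Pi.single_eq_of_ne, smul_zero, Pi.zero_apply]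
    rintro rfl
    simp at hi
    omega
  · rfl

/-- The velocity of the lift to `T^kQ` projects to `j_{k-r+1}` on `T^{k-r}Q`, so `J_r` sends it to
`Δ_r`. -/
theorem canFieldApply_lift {r : ℕ} (h1 : 1 ≤ r) (h : r ≤ k) (L : HOTangent n k Q → ℝ) {x : Q}
    {σ : Curve n Q} {t : ℝ} (hx : σ t ∈ (chartAt (Coord n) x).source) :
    vertDiff h L (lift k σ t) (jetVec k x σ (deriv fun s => chartAt (Coord n) x (σ s)) t) =
      canFieldApply h1 h L (lift k σ t) := by
  unfold vertDiff canFieldApply canField vertEndo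
  rw [ContinuousLinearMap.comp_apply, ContinuousLinearMap.comp_apply, projT_jetVec _ hx,
    canInj_lift (by omega) hx]

/-- The coordinates `(q_1, …, q_k, 0)`. -/
def shiftDown (n k : ℕ) (q : JetCoord n k) : JetCoord n k := fun i =>
  if h : (i : ℕ) + 1 < k + 1 then q ⟨i + 1, h⟩ else 0

theorem contDiff_shiftDown : ContDiff ℝ ∞ (shiftDown n k) := by
  refine contDiff_pi.2 fun i => ?_
  unfold shiftDown
  split_ifs <;> fun_prop

/-- The last component of the velocity of a lift is `q_{k+1}`, which is not a function on `T^kQ`. As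
`r ≥ 1`, `J_r` never reads it, so the zero placed there by `shiftDown` is harmless. -/
theorem contMDiff_canFieldApply {r : ℕ} (h1 : 1 ≤ r) (h : r ≤ k) {L : HOTangent n k Q → ℝ}
    (hL : ContMDiff 𝓘(ℝ, JetCoord n k) 𝓘(ℝ, ℝ) ∞ L) :
    ContMDiff 𝓘(ℝ, JetCoord n k) 𝓘(ℝ, ℝ) ∞ (canFieldApply h1 h L) := by
  refine contMDiff_of_forall_chart fun x => ?_
  refine (contMDiffOn_vertDiff_coordVec h hL x contDiff_shiftDown).congr fun p hp => ?_
  obtain ⟨σ, rfl⟩ := jet_surj p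
  have hx : σ 0 ∈ (chartAt (Coord n) x).source := hp
  change (jet k σ).base ∈ (chartAt (Coord n) x).source at hp
  rw [← lift_zero] at hp ⊢
  rw [← canFieldApply_lift h1 h L hx, jetVec, vertDiff_coordVec h hL hp, vertDiff_coordVec h hL hp]
  congr 1
  funext i
  rw [shiftUp_apply, shiftUp_apply]
  split_ifs with hi
  · congr 1
    rw [iteratedDeriv_deriv, natCoord_lift hx, shiftDown, dif_pos (by simp; omega)]
    rfl
  · rfl

end Vertical

/-! ### The Legendre–Ostrogradsky map and the energy -/

section Legendre

variable {n k : ℕ} {Q : Type*} [TopologicalSpace Q] [ChartedSpace (Coord n) Q]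
  [IsManifold (𝓡 n) ∞ Q]

theorem IsSemibasic.apply_eq_zero {θ : OneForm n k Q} {j : ℕ} (hθ : IsSemibasic j θ)
    (p : HOTangent n k Q) {V : JetCoord n k} (hV : ∀ i : Fin (k + 1), (i : ℕ) ≤ j → V i = 0) :
    θ p V = 0 := by
  have h : V = coordVec p.base p V := (coordVec_base p V).symm
  refine (congrArg (θ p) (h.trans (sum_partialQ _ _ _))).trans ?_
  simp only [map_sum, map_smul]
  refine Finset.sum_eq_zero fun i _ => Finset.sum_eq_zero fun A _ => ?_
  by_cases hi : (i : ℕ) ≤ j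
  · rw [hV i hi]
    simp
  · rw [hθ p.base p (mem_chart_source _ _) i (by omega), smul_zero]

theorem projT_eq {r : ℕ} (h : r ≤ k) (p : HOTangent n k Q) (V : JetCoord n k) :
    projT h p V = truncate n h V :=
  (congrArg (projT h p) (coordVec_base p V).symm).trans
    ((projT_coordVec h (mem_chart_source _ _) V).trans (coordVec_of_eq (base_proj h p).symm _))

theorem lagrangianForm_apply (L : HOTangent n k Q → ℝ) (p : HOTangent n (2 * k - 1) Q)
    (u : TSp p) : lagrangianForm L p u =
      ∑ s : Fin k, ((-1 : ℝ) ^ (s : ℕ) / (((s : ℕ) + 1).factorial : ℝ)) *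
        dTFormIter (vertDiff (r := s + 1) (by omega) L) s (proj (by omega) p)
          (projT (by omega) p u) := by
  unfold lagrangianForm
  rw [sum_apply]
  rfl

/-- `θ_L` vanishes on vectors that project to zero on `T^{k-1} Q`. -/
theorem lagrangianForm_eq_zero {L : HOTangent n k Q → ℝ}
    (hL : ContMDiff 𝓘(ℝ, JetCoord n k) 𝓘(ℝ, ℝ) ∞ L) (p : HOTangent n (2 * k - 1) Q)
    {V : JetCoord n (2 * k - 1)} (hV : ∀ i : Fin (2 * k - 1 + 1), (i : ℕ) ≤ k - 1 → V i = 0) :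
    lagrangianForm L p V = 0 := by
  refine (lagrangianForm_apply L p V).trans (Finset.sum_eq_zero fun s _ => ?_)
  rw [projT_eq]
  -- With `r = s + 1`, the order `k - r` is raised `s` times, giving `k - 1` for every term of the
  -- sum.
  have h := (isSemibasic_vertDiff (r := (s : ℕ) + 1) (by omega) hL).dTFormIter
    (smoothForm_vertDiff _ hL) s
  rw [h.apply_eq_zero, mul_zero]
  intro i hi
  exact hV _ (by simp; omega)

theorem existsUnique_isLegendreValue {L : HOTangent n k Q → ℝ}
    (hL : ContMDiff 𝓘(ℝ, JetCoord n k) 𝓘(ℝ, ℝ) ∞ L) (p : HOTangent n (2 * k - 1) Q) :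
    ∃! α, IsLegendreValue L p α := by
  have hk : k - 1 ≤ 2 * k - 1 := by omega
  -- Padding by zeros is a section of the truncation. Composing `θ_L` with it gives the covector,
  -- because `θ_L` vanishes on the difference; the same section forces uniqueness.
  let S : JetCoord n (k - 1) →L[ℝ] JetCoord n (2 * k - 1) :=
    ContinuousLinearMap.pi fun i => if h : (i : ℕ) < k - 1 + 1 then
      ContinuousLinearMap.proj (⟨i, h⟩ : Fin (k - 1 + 1)) else 0
  have hS : ∀ W i, S W i = if h : (i : ℕ) < k - 1 + 1 then W ⟨i, h⟩ else 0 := by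
    intro W i
    simp only [S, ContinuousLinearMap.pi_apply]
    split_ifs <;> rfl
  have hSp : ∀ W : JetCoord n (k - 1), truncate n hk (S W) = W := by
    intro W
    funext i
    rw [truncate_apply, hS, dif_pos (by exact i.2)]
    rfl
  let θ : JetCoord n (2 * k - 1) →L[ℝ] ℝ := lagrangianForm L p
  let α : JetCoord n (k - 1) →L[ℝ] ℝ := θ.comp S
  refine ⟨α, fun u => ?_, fun β hβ => ?_⟩
  · let V : JetCoord n (2 * k - 1) := u
    have h0 : θ (V - S (truncate n hk V)) = 0 := by
      refine lagrangianForm_eq_zero hL p fun i hi => ?_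
      rw [Pi.sub_apply, hS, dif_pos (by omega), sub_eq_zero]
      rfl
    rw [map_sub, sub_eq_zero] at h0
    refine Eq.trans h0 ?_
    exact congrArg α (projT_eq hk p V).symm
  · refine ContinuousLinearMap.ext fun W => ?_
    have h := hβ (S W)
    have h' : projT hk p (S W) = W := (projT_eq hk p (S W)).trans (hSp W)
    rw [h'] at h
    exact h.symm

theorem isLegendreValue_iff {L : HOTangent n k Q → ℝ}
    (hL : ContMDiff 𝓘(ℝ, JetCoord n k) 𝓘(ℝ, ℝ) ∞ L) (p : HOTangent n (2 * k - 1) Q) (α) :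
    IsLegendreValue L p α ↔ α = legendreMap L p := by
  have hu := existsUnique_isLegendreValue hL p
  have h : IsLegendreValue L p (legendreMap L p) := by
    unfold legendreMap
    rw [dif_pos hu.exists]
    exact hu.exists.choose_spec
  exact ⟨fun hα => hu.unique hα h, fun hα => hα ▸ h⟩

theorem contMDiff_lagrangianEnergy (hk : 1 ≤ k) {L : HOTangent n k Q → ℝ}
    (hL : ContMDiff 𝓘(ℝ, JetCoord n k) 𝓘(ℝ, ℝ) ∞ L) :
    ContMDiff 𝓘(ℝ, JetCoord n (2 * k - 1)) 𝓘(ℝ, ℝ) ∞ (lagrangianEnergy hk L) := by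
  unfold lagrangianEnergy
  refine ContMDiff.sub (contMDiff_finsetSum fun s _ => ?_) (hL.comp (contMDiff_proj _))
  exact contMDiff_const.mul
    ((contMDiff_dTIter (contMDiff_canFieldApply _ _ hL) s).comp (contMDiff_proj _))

/-- Contraction of `θ_L` with the velocity of a lifted curve. -/
theorem lagrangianForm_velocity (hk : 1 ≤ k) {L : HOTangent n k Q → ℝ}
    (hL : ContMDiff 𝓘(ℝ, JetCoord n k) 𝓘(ℝ, ℝ) ∞ L) {x : Q} {σ : Curve n Q} {t : ℝ}
    (hx : σ t ∈ (chartAt (Coord n) x).source) :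
    lagrangianForm L (lift (2 * k - 1) σ t)
      (jetVec (2 * k - 1) x σ (deriv fun s => chartAt (Coord n) x (σ s)) t) =
    lagrangianEnergy hk L (lift (2 * k - 1) σ t) + L (lift k σ t) := by
  unfold lagrangianEnergy
  rw [proj_lift, sub_add_cancel, lagrangianForm_apply]
  refine Finset.sum_congr rfl fun s _ => ?_
  rw [projT_jetVec _ hx]
  congr 1
  exact dTFormIter_velocity (smoothForm_vertDiff _ hL) (contMDiff_canFieldApply (by omega) _ hL)
    (fun u hu => canFieldApply_lift (by omega) _ L hu) s hx

/-- The energy is the Hamiltonian along the graph of the Legendre–Ostrogradsky map. -/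
theorem lagrangianEnergy_eq (hk : 1 ≤ k) {L : HOTangent n k Q → ℝ}
    (hL : ContMDiff 𝓘(ℝ, JetCoord n k) 𝓘(ℝ, ℝ) ∞ L) (p : HOTangent n (2 * k - 1) Q) :
    lagrangianEnergy hk L p = unifiedHamiltonian hk L ⟨p, legendreMap L p⟩ := by
  obtain ⟨σ, rfl⟩ := exists_lift p
  have hx : σ 0 ∈ (chartAt (Coord n) (σ 0)).source := mem_chart_source _ _
  have h1 := lagrangianForm_velocity hk hL hx
  -- The velocity depends on the `2k`-jet of the chosen `σ`, but its projection to `T^{k-1}Q` is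
  -- `j_k(p)`, so the pairing with `FL(p)` is the coupling.
  rw [(isLegendreValue_iff hL _ _).2 rfl, projT_jetVec _ hx] at h1
  unfold unifiedHamiltonian coupling
  rw [canInj_lift _ hx]
  exact eq_sub_of_add_eq h1.symm

end Legendre

end HigherOrder

end

open HigherOrder in
theorem mainTheorem10 (n k : ℕ) (hk : 1 ≤ k) (Q : Type*) [TopologicalSpace Q]
    [ChartedSpace (Coord n) Q] [IsManifold (𝓡 n) ∞ Q] (L : HOTangent n k Q → ℝ)
    (hL : ContMDiff 𝓘(ℝ, JetCoord n k) 𝓘(ℝ, ℝ) ∞ L) :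
    (∀ p α, IsLegendreValue L p α ↔ α = legendreMap L p) ∧
    (∃! E : HOTangent n (2 * k - 1) Q → ℝ,
      ContMDiff 𝓘(ℝ, JetCoord n (2 * k - 1)) 𝓘(ℝ, ℝ) ∞ E ∧
        ∀ w ∈ legendreGraph L, E w.pr₁ = unifiedHamiltonian hk L w) ∧
    ∀ E : HOTangent n (2 * k - 1) Q → ℝ,
      ContMDiff 𝓘(ℝ, JetCoord n (2 * k - 1)) 𝓘(ℝ, ℝ) ∞ E →
        (∀ w ∈ legendreGraph L, E w.pr₁ = unifiedHamiltonian hk L w) →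
          E = lagrangianEnergy hk L := by
  have huniq : ∀ E : HOTangent n (2 * k - 1) Q → ℝ,
      (∀ w ∈ legendreGraph L, E w.pr₁ = unifiedHamiltonian hk L w) →
        E = lagrangianEnergy hk L := by
    intro E hE
    funext p
    rw [lagrangianEnergy_eq hk hL]
    -- The graph meets the fibre over every `p`, so its points prescribe all values of `E`.
    exact hE ⟨p, legendreMap L p⟩ rfl
  refine ⟨isLegendreValue_iff hL, ⟨lagrangianEnergy hk L,
    ⟨contMDiff_lagrangianEnergy hk hL, ?_⟩, fun E hE => huniq E hE.2⟩, fun E _ hE => huniq E hE⟩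
  rintro ⟨p, α⟩ hw
  have hα : α = legendreMap L p := hw
  subst hα
  exact lagrangianEnergy_eq hk hL p
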